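/- For a real square matrix let $\|\cdot\|_F$, $\|\cdot\|_2$, $\|\cdot\|_*$ be the Frobenius, spectral and nuclear norms, and let $A_k$ denote a best rank-$k$ approximation (truncated SVD) of $A$. For an $m\times m$ SPSD matrix $A$ and $c$ distinct column indices, let $C$ consist of these columns of $A$ and let $W$ be the $c\times c$ submatrix of $A$ with these row and column indices. The standard Nyström approximation is $\tilde A=CW^\dagger C^T$. The ensemble Nyström approximation from $t\ge 1$ pairwise disjoint samples of $c$ columns, with equal weights, is $\tilde A=\frac1t\sum_{i=1}^t C^{(i)}{W^{(i)}}^\dagger {C^{(i)}}^T$. For $\alpha\in[0,1)$ let $B_{m,\alpha}=(1-\alpha)I_m+\alpha \mathbf 1_m\mathbf 1_m^T$ and, for $m=kp$, let $A_{m,k,\alpha}$ be the $m\times m$ block diagonal matrix with $k$ diagonal blocks $B_{p,\alpha}$. These matrices are SPSD. Let $1\le k<m$ and $1\le c<m$, and whenever $A_{m,k,\alpha}$ is used let $k$ divide $m$. (Below, the square root of a negative number is read as $0$.) (a) Additive-error bounds: put $\alpha=1/100$. For every choice of the columns, the standard method satisfies, with $A=B_{m,\alpha}$, $$\frac{\|A-\tilde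 A\|_2}{\max_{i,j}|a_{ij}|}\ge\frac{0.99(m+99)}{c+99},$$ and, with $A=A_{m,k,\alpha}$, $$\frac{\|A-\tilde A\|_F}{\max_{i,j}|a_{ij}|}\ge 0.99\sqrt{m-c-k+k\Big(\frac{m+99k}{c+99k}\Big)^2},\qquad \frac{\|A-\tilde A\|_*}{\max_{i,j}|a_{ij}|}\ge 0.99(m-c)\Big(1+\frac{k}{c+99k}\Big).$$ For every choice of $t$ disjoint samples, the ensemble method with $A=A_{m,k,\alpha}$ satisfies $$\frac{\|A-\tilde A\|_F}{\max_{i,j}|a_{ij}|}\ge 0.99\sqrt{\Big(m-2c+\frac ct-k\Big)+k\Big(\frac{m-c+\frac ct+99k}{c+99k}\Big)^2},\qquad \frac{\|A-\tilde A\|_*}{\max_{i,j}|a_{ij}|}\ge 0.99(m-c)\Big(1+\frac{k}{c+99k}\Big).$$ (b) Relative-error bounds, in the limit $\alpha\to1$: for every $\varepsilon>0$ and all $\alpha<1$ sufficiently close to $1$ (depending on $\varepsilon$ and the integer parameters, but not on the chosen columns), for every choice of the columns the standard method satisfies, with $A=B_{m,\alpha}$, $$\frac{\|A-\tilde A\|_2}{\|A-A_k\|_2}\ge\frac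 mc-\varepsilon,$$ and, with $A=A_{m,k,\alpha}$, $$\frac{\|A-\tilde A\|_F}{\|A-A_k\|_F}\ge\sqrt{1+\frac{m^2k-c^3}{c^2(m-k)}}-\varepsilon,\qquad \frac{\|A-\tilde A\|_*}{\|A-A_k\|_*}\ge\frac{m-c}{m-k}\Big(1+\frac kc\Big)-\varepsilon;$$ and for every choice of $t$ disjoint samples the ensemble method with $A=A_{m,k,\alpha}$ satisfies $$\frac{\|A-\tilde A\|_F}{\|A-A_k\|_F}\ge\sqrt{\frac{m-2c+c/t-k}{m-k}\Big(1+\frac{k(m-2c+c/t)}{c^2}\Big)}-\varepsilon,\qquad \frac{\|A-\tilde A\|_*}{\|A-A_k\|_*}\ge\frac{m-c}{m-k}\Big(1+\frac kc\Big)-\varepsilon .$$ -/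

import Mathlib

open Matrix

noncomputable section

namespace Nystrom

/-! ### Norms of a real square matrix -/

/-- The Frobenius norm `(∑ a_ij ^ 2) ^ (1/2)`. -/
def frobNorm {n : Type*} [Fintype n] (A : Matrix n n ℝ) : ℝ :=
  √(∑ i, ∑ j, A i j ^ 2)

/-- The spectral norm: the operator norm with respect to Euclidean norms. -/
def specNorm {n : Type*} [Fintype n] [DecidableEq n] (A : Matrix n n ℝ) : ℝ :=
  ‖Matrix.toEuclideanCLM (n := n) (𝕜 := ℝ) A‖

/-- The nuclear norm: the sum of the singular values (Mathlib indexes them from `0`, in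
decreasing order; the ones of index at least the size of the matrix vanish). -/
def nucNorm {n : Type*} [Fintype n] [DecidableEq n] (A : Matrix n n ℝ) : ℝ :=
  ∑ i ∈ Finset.range (Fintype.card n), A.toEuclideanLin.singularValues i

/-- `max_{i,j} |a_ij|`. -/
def maxAbs {n : Type*} (A : Matrix n n ℝ) : ℝ :=
  ⨆ q : n × n, |A q.1 q.2|

/-! ### Best rank-`k` approximation -/

/-- `Ak` is a best rank-`k` approximation of `A` in the sense of the truncated singular value
decomposition: `A = U diag(σ) Vᵀ` with `U`, `V` orthogonal and `σ ≥ 0`, and `Ak` keeps exactly `k`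
largest singular values (those with index in `T`). -/
def IsTruncatedSVD {n : Type*} [Fintype n] [DecidableEq n]
    (A : Matrix n n ℝ) (k : ℕ) (Ak : Matrix n n ℝ) : Prop :=
  ∃ (U V : Matrix n n ℝ) (σ : n → ℝ) (T : Finset n),
    U ∈ Matrix.orthogonalGroup n ℝ ∧ V ∈ Matrix.orthogonalGroup n ℝ ∧
    (∀ i, 0 ≤ σ i) ∧ T.card = k ∧ (∀ i ∈ T, ∀ j ∉ T, σ j ≤ σ i) ∧
    A = U * Matrix.diagonal σ * Vᵀ ∧
    Ak = U * Matrix.diagonal (fun i => if i ∈ T then σ i else 0) * Vᵀ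

/-- Truncated singular value decompositions of positive semidefinite matrices exist. -/
theorem exists_isTruncatedSVD {n : Type*} [Fintype n] [DecidableEq n] {A : Matrix n n ℝ}
    (hA : A.PosSemidef) {k : ℕ} (hk : k ≤ Fintype.card n) : ∃ Ak, IsTruncatedSVD A k Ak := by
  have hH := hA.isHermitian
  obtain ⟨T, hT, hTop⟩ : ∃ T : Finset n, T.card = k ∧
      ∀ i ∈ T, ∀ j ∉ T, hH.eigenvalues j ≤ hH.eigenvalues i := by
    induction k with
    | zero => exact ⟨∅, rfl, by simp⟩
    | succ k ih =>
      obtain ⟨T, hT, hTop⟩ := ih (by omega)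
      have hne : (Tᶜ).Nonempty := by
        rw [← Finset.card_pos, Finset.card_compl]; omega
      obtain ⟨a, ha, hmax⟩ := Finset.exists_max_image Tᶜ hH.eigenvalues hne
      have ha' : a ∉ T := by simpa using ha
      refine ⟨insert a T, by rw [Finset.card_insert_of_notMem ha', hT], ?_⟩
      intro i hi j hj
      rw [Finset.mem_insert, not_or] at hj
      rcases Finset.mem_insert.1 hi with rfl | hi
      · exact hmax j (by simpa using hj.2)
      · exact hTop i hi j hj.2
  refine ⟨_, hH.eigenvectorUnitary, hH.eigenvectorUnitary, hH.eigenvalues, T,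
    hH.eigenvectorUnitary.2, hH.eigenvectorUnitary.2, hA.eigenvalues_nonneg, hT, hTop, ?_, rfl⟩
  have h := hH.spectral_theorem
  rw [Unitary.conjStarAlgAut_apply, Matrix.star_eq_conjTranspose,
    Matrix.conjTranspose_eq_transpose_of_trivial] at h
  exact h

/-! ### The Moore-Penrose inverse -/

/-- The four Penrose equations. -/
def IsMoorePenrose {m n : Type*} [Fintype m] [Fintype n]
    (M : Matrix m n ℝ) (X : Matrix n m ℝ) : Prop :=
  M * X * M = M ∧ X * M * X = X ∧ (M * X)ᵀ = M * X ∧ (X * M)ᵀ = X * M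

/-- Every symmetric real matrix has a symmetric Moore-Penrose inverse. -/
theorem exists_isMoorePenrose_symm {n : Type*} [Fintype n] (M : Matrix n n ℝ) (hM : Mᵀ = M) :
    ∃ X, IsMoorePenrose M X ∧ Xᵀ = X := by
  classical
  have hH : M.IsHermitian := by
    rw [Matrix.IsHermitian, Matrix.conjTranspose_eq_transpose_of_trivial, hM]
  obtain ⟨U, d, hU, hMU⟩ : ∃ (U : Matrix n n ℝ) (d : n → ℝ), Uᵀ * U = 1 ∧
      M = U * Matrix.diagonal d * Uᵀ := by
    refine ⟨hH.eigenvectorUnitary, hH.eigenvalues, ?_, ?_⟩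
    · have h := Unitary.coe_star_mul_self hH.eigenvectorUnitary
      rwa [Matrix.star_eq_conjTranspose, Matrix.conjTranspose_eq_transpose_of_trivial] at h
    · have h := hH.spectral_theorem
      rw [Unitary.conjStarAlgAut_apply, Matrix.star_eq_conjTranspose,
        Matrix.conjTranspose_eq_transpose_of_trivial] at h
      exact h
  have key : ∀ e f : n → ℝ, (U * Matrix.diagonal e * Uᵀ) * (U * Matrix.diagonal f * Uᵀ) =
      U * Matrix.diagonal (fun i => e i * f i) * Uᵀ := by
    intro e f
    rw [← Matrix.diagonal_mul_diagonal]
    calc _ = U * Matrix.diagonal e * (Uᵀ * U) * Matrix.diagonal f * Uᵀ := by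
            simp only [Matrix.mul_assoc]
      _ = _ := by rw [hU]; simp only [Matrix.mul_assoc, Matrix.one_mul]
  have tr : ∀ e : n → ℝ, (U * Matrix.diagonal e * Uᵀ)ᵀ = U * Matrix.diagonal e * Uᵀ := by
    intro e
    simp [Matrix.transpose_mul, Matrix.mul_assoc]
  refine ⟨U * Matrix.diagonal (fun i => (d i)⁻¹) * Uᵀ, ⟨?_, ?_, ?_, ?_⟩, tr _⟩
  · rw [hMU, key, key]
    congr 3; funext i
    exact mul_inv_mul_cancel (d i)
  · rw [hMU, key, key]
    congr 3; funext i
    simpa using mul_inv_mul_cancel (d i)⁻¹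
  · rw [hMU, key, tr]
  · rw [hMU, key, tr]

/-- Every real matrix has a Moore-Penrose inverse. -/
theorem exists_isMoorePenrose {m n : Type*} [Fintype m] [Fintype n] (M : Matrix m n ℝ) :
    ∃ X, IsMoorePenrose M X := by
  classical
  obtain ⟨H, ⟨h1, h2, h3, h4⟩, hs⟩ := exists_isMoorePenrose_symm (Mᵀ * M)
    (by rw [Matrix.transpose_mul, Matrix.transpose_transpose])
  have hk : M * (H * (Mᵀ * M)) = M := by
    have h0 : Mᴴ * M * (H * (Mᵀ * M) - 1) = 0 := by
      rw [Matrix.conjTranspose_eq_transpose_of_trivial, Matrix.mul_sub, ← Matrix.mul_assoc, h1,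
        Matrix.mul_one, sub_self]
    have h5 := (Matrix.conjTranspose_mul_self_mul_eq_zero M _).1 h0
    rw [Matrix.mul_sub, Matrix.mul_one, sub_eq_zero] at h5
    exact h5
  refine ⟨H * Mᵀ, ?_, ?_, ?_, ?_⟩
  · simpa only [Matrix.mul_assoc] using hk
  · calc H * Mᵀ * M * (H * Mᵀ) = (H * (Mᵀ * M) * H) * Mᵀ := by simp only [Matrix.mul_assoc]
      _ = _ := by rw [h2]
  · simp [Matrix.transpose_mul, hs, Matrix.mul_assoc]
  · rw [Matrix.mul_assoc, h4]

/-- The Moore-Penrose inverse is unique. -/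
theorem IsMoorePenrose.unique {m n : Type*} [Fintype m] [Fintype n]
    {M : Matrix m n ℝ} {X Y : Matrix n m ℝ}
    (hX : IsMoorePenrose M X) (hY : IsMoorePenrose M Y) : X = Y := by
  obtain ⟨x1, x2, x3, x4⟩ := hX
  obtain ⟨y1, y2, y3, y4⟩ := hY
  have hl : M * X = M * Y := by
    calc M * X = (M * X)ᵀ := x3.symm
      _ = (M * Y * M * X)ᵀ := by rw [y1]
      _ = (M * X)ᵀ * (M * Y)ᵀ := by rw [← Matrix.transpose_mul]; simp only [Matrix.mul_assoc]
      _ = M * X * M * Y := by rw [x3, y3]; simp only [Matrix.mul_assoc]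
      _ = M * Y := by rw [x1]
  have hr : X * M = Y * M := by
    calc X * M = (X * M)ᵀ := x4.symm
      _ = (X * (M * Y * M))ᵀ := by rw [y1]
      _ = (Y * M)ᵀ * (X * M)ᵀ := by rw [← Matrix.transpose_mul]; simp only [Matrix.mul_assoc]
      _ = Y * (M * X * M) := by rw [x4, y4]; simp only [Matrix.mul_assoc]
      _ = Y * M := by rw [x1]
  calc X = X * M * X := x2.symm
    _ = Y * M * X := by rw [hr]
    _ = Y * (M * X) := Matrix.mul_assoc _ _ _
    _ = Y * M * Y := by rw [hl, Matrix.mul_assoc]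
    _ = Y := y2

/-- The Moore-Penrose inverse of a real matrix. -/
def pinv {m n : Type*} [Fintype m] [Fintype n] (M : Matrix m n ℝ) : Matrix n m ℝ :=
  (exists_isMoorePenrose M).choose

/-! ### The conventional Nyström methods -/

/-- The standard Nyström approximation `C W† Cᵀ` of `A` from the `c` distinct columns with indices
`s 0, …, s (c-1)`: `C` consists of these columns, `W` of the rows of `C` with the same indices. -/
def nystrom {n : Type*} {c : ℕ} (A : Matrix n n ℝ) (s : Fin c ↪ n) : Matrix n n ℝ :=
  A.submatrix id s * pinv (A.submatrix s s) * (A.submatrix id s)ᵀ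

/-- The ensemble Nyström approximation `∑ i, μ i • C⁽ⁱ⁾ W⁽ⁱ⁾† C⁽ⁱ⁾ᵀ` with weights `μ`. -/
def ensemble {n : Type*} {t c : ℕ} (μ : Fin t → ℝ) (A : Matrix n n ℝ)
    (s : Fin t → (Fin c ↪ n)) : Matrix n n ℝ :=
  ∑ i, μ i • nystrom A (s i)

/-- The samples do not overlap. -/
def NonOverlapping {n : Type*} {t c : ℕ} (s : Fin t → (Fin c ↪ n)) : Prop :=
  Pairwise fun i j => Disjoint (Set.range (s i)) (Set.range (s j))

/-! ### The adversarial matrices -/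

/-- The `m × m` matrix `(1 - α) I + α 1 1ᵀ`. -/
def matB (m : ℕ) (α : ℝ) : Matrix (Fin m) (Fin m) ℝ :=
  (1 - α) • (1 : Matrix (Fin m) (Fin m) ℝ) + α • Matrix.of fun _ _ => (1 : ℝ)

/-- The block diagonal matrix with `k` blocks `matB p α`, of size `m × m` with `m = k * p`. -/
def matA (k p : ℕ) (α : ℝ) : Matrix (Fin p × Fin k) (Fin p × Fin k) ℝ :=
  Matrix.blockDiagonal fun _ : Fin k => matB p α

end Nystrom

end

noncomputable section

namespace Nystrom

/-! ### Norms of matrices given by a singular value decomposition -/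

section Norms

/-! Both families have the form `(1 - α) I + α J`, where `J` is the indicator of a partition into
blocks of equal size `p` (`partMat`), and their Nyström residual is explicit. With `β = (1 - α) /
α`, it is `1 - α` times a matrix supported on the unsampled indices; in a block `b` containing `c_b`
samples this matrix is `I + (c_b + β)⁻¹ 1 1ᵀ` on the unsampled indices (`sub_nystrom_partMat`). The
column choice therefore enters a single residual's error only through the counts `c_b`, whose sum is
`c`, and convexity shows that the bounds are attained or undercut by equal counts `c / k`.

For the nuclear norm, residuals and their averages are positive semidefinite, so the norm is a
trace, linear in the samples and convex in the counts (`nucNorm_sub_ensemble_ge`). For the Frobenius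
norm, the square of an average expands into pairwise inner products (`sum_sub_nystrom_mul`), and
disjointness makes the cross terms depend on the counts alone. `sq_le_sum_cross` averages over the
samples inside one block, then `card_mul_sq_le_sum_sq` averages over the blocks. For the spectral
norm there is one block, and the indicator of the unsampled set is an eigenvector. The standard
method is the ensemble method with `t = 1`.

For the relative bounds, `(partMat π α)ᵀ * partMat π α` has just two eigenvalues, so every singular
value left out of a rank-`k` truncation equals `1 - α` (`IsTruncatedSVD.sub_eq`). The factor `1 - α`
cancels in the quotient, leaving a function of `β` continuous at `0`. Thus `α → 1` is `β → 0`, while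
`α = 1/100` is `β = 99`. -/

theorem sum_sum_sq_eq_trace {n : Type*} [Fintype n] (A : Matrix n n ℝ) : ∑ i, ∑ j, A i j ^ 2 = (Aᵀ * A).trace := by
  rw [Finset.sum_comm]
  simp [Matrix.trace, Matrix.mul_apply, sq]

variable {n : Type*} [Fintype n] [DecidableEq n]

theorem transpose_mul_self_eq {U V : Matrix n n ℝ} (σ : n → ℝ)
    (hU : U ∈ Matrix.orthogonalGroup n ℝ) :
    (U * diagonal σ * Vᵀ)ᵀ * (U * diagonal σ * Vᵀ) = V * diagonal (fun i => σ i ^ 2) * Vᵀ := by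
  have h : Uᵀ * U = 1 := (Matrix.mem_orthogonalGroup_iff' n ℝ).1 hU
  calc _ = V * (diagonal σ * (Uᵀ * U) * diagonal σ) * Vᵀ := by
        simp only [transpose_mul, transpose_transpose, diagonal_transpose, Matrix.mul_assoc]
    _ = _ := by
        rw [h, Matrix.mul_one, diagonal_mul_diagonal]
        simp only [sq]

theorem trace_conj_diagonal {V : Matrix n n ℝ} (σ : n → ℝ)
    (hV : V ∈ Matrix.orthogonalGroup n ℝ) : (V * diagonal σ * Vᵀ).trace = ∑ i, σ i := by
  have h : Vᵀ * V = 1 := (Matrix.mem_orthogonalGroup_iff' n ℝ).1 hV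
  rw [Matrix.trace_mul_comm, ← Matrix.mul_assoc, h, Matrix.one_mul, Matrix.trace_diagonal]

theorem frobNorm_mul_diagonal_mul {U V : Matrix n n ℝ} (σ : n → ℝ)
    (hU : U ∈ Matrix.orthogonalGroup n ℝ) (hV : V ∈ Matrix.orthogonalGroup n ℝ) :
    frobNorm (U * diagonal σ * Vᵀ) = √(∑ i, σ i ^ 2) := by
  rw [frobNorm, sum_sum_sq_eq_trace, transpose_mul_self_eq σ hU, trace_conj_diagonal _ hV]

theorem transpose_mem_orthogonalGroup {V : Matrix n n ℝ} (hV : V ∈ Matrix.orthogonalGroup n ℝ) :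
    Vᵀ ∈ Matrix.orthogonalGroup n ℝ := by
  rw [Matrix.mem_orthogonalGroup_iff, Matrix.transpose_transpose]
  exact (Matrix.mem_orthogonalGroup_iff' n ℝ).1 hV

open scoped Matrix.Norms.L2Operator in
theorem specNorm_mul_diagonal_mul {U V : Matrix n n ℝ} (σ : n → ℝ)
    (hU : U ∈ Matrix.orthogonalGroup n ℝ) (hV : V ∈ Matrix.orthogonalGroup n ℝ) :
    specNorm (U * diagonal σ * Vᵀ) = ‖σ‖ := by
  have h : specNorm (U * diagonal σ * Vᵀ) = ‖U * diagonal σ * Vᵀ‖ :=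
    Matrix.l2_opNorm_toEuclideanCLM _
  rw [h, CStarRing.norm_mul_mem_unitary _ (transpose_mem_orthogonalGroup hV),
    CStarRing.norm_mem_unitary_mul _ hU, Matrix.l2_opNorm_diagonal]

theorem roots_charpoly_diagonal (σ : n → ℝ) :
    (diagonal σ).charpoly.roots = Finset.univ.val.map σ := by
  rw [Matrix.charpoly_diagonal]
  have h := Polynomial.roots_multiset_prod_X_sub_C (Finset.univ.val.map σ)
  rwa [Multiset.map_map] at h

/-- Singular values are square roots of the eigenvalues of `AᵀA`. The multiset of roots forgets
their ordering, and the characteristic polynomial is invariant under orthogonal conjugation, so the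
norm can be read off from any singular value decomposition, sorted or not. -/
theorem nucNorm_eq_sum_sqrt_roots (A : Matrix n n ℝ) :
    nucNorm A = ((Aᵀ * A).charpoly.roots.map Real.sqrt).sum := by
  have hn : Module.finrank ℝ (EuclideanSpace ℝ n) = Fintype.card n := by simp
  set T := A.toEuclideanLin with hT
  have hchar : (LinearMap.adjoint T ∘ₗ T).charpoly = (Aᵀ * A).charpoly := by
    rw [hT, ← Matrix.toEuclideanLin_conjTranspose_eq_adjoint,
      Matrix.conjTranspose_eq_transpose_of_trivial]
    have : Aᵀ.toEuclideanLin ∘ₗ A.toEuclideanLin =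
        Matrix.toLin (EuclideanSpace.basisFun n ℝ).toBasis
          (EuclideanSpace.basisFun n ℝ).toBasis (Aᵀ * A) := by
      rw [Matrix.toLin_mul _ (EuclideanSpace.basisFun n ℝ).toBasis,
        Matrix.toEuclideanLin_eq_toLin_orthonormal]
    rw [this, ← LinearMap.charpoly_toMatrix _ (EuclideanSpace.basisFun n ℝ).toBasis,
      LinearMap.toMatrix_toLin]
  rw [nucNorm, ← hchar, T.isSymmetric_adjoint_comp_self.roots_charpoly_eq_eigenvalues hn,
    Finset.sum_range]
  rw [Multiset.map_map]
  change ∑ i : Fin (Fintype.card n), T.singularValues i = _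
  simp only [T.singularValues_fin hn]
  rfl

theorem nucNorm_mul_diagonal_mul {U V : Matrix n n ℝ} {σ : n → ℝ}
    (hU : U ∈ Matrix.orthogonalGroup n ℝ) (hV : V ∈ Matrix.orthogonalGroup n ℝ)
    (hσ : ∀ i, 0 ≤ σ i) : nucNorm (U * diagonal σ * Vᵀ) = ∑ i, σ i := by
  have h : Vᵀ * V = 1 := (Matrix.mem_orthogonalGroup_iff' n ℝ).1 hV
  rw [nucNorm_eq_sum_sqrt_roots, transpose_mul_self_eq σ hU, Matrix.charpoly_mul_comm,
    ← Matrix.mul_assoc, h, Matrix.one_mul, roots_charpoly_diagonal, Multiset.map_map]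
  change ∑ i, √(σ i ^ 2) = _
  exact Finset.sum_congr rfl fun i _ => Real.sqrt_sq (hσ i)

theorem nucNorm_eq_trace {A : Matrix n n ℝ} (hA : A.PosSemidef) : nucNorm A = A.trace := by
  have h := hA.isHermitian.spectral_theorem
  rw [Unitary.conjStarAlgAut_apply, Matrix.star_eq_conjTranspose,
    Matrix.conjTranspose_eq_transpose_of_trivial] at h
  have hU : (hA.isHermitian.eigenvectorUnitary : Matrix n n ℝ) ∈ Matrix.orthogonalGroup n ℝ :=
    hA.isHermitian.eigenvectorUnitary.2
  have h' : A = _ * diagonal hA.isHermitian.eigenvalues * _ := h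
  have h1 := nucNorm_mul_diagonal_mul hU hU hA.eigenvalues_nonneg
  have h2 := trace_conj_diagonal hA.isHermitian.eigenvalues hU
  rw [← h'] at h1 h2
  rw [h1, h2]

theorem le_specNorm_of_mulVec {A : Matrix n n ℝ} {v : n → ℝ} (hv : v ≠ 0) {l : ℝ}
    (h : A *ᵥ v = l • v) : l ≤ specNorm A := by
  have h0 : 0 < ‖WithLp.toLp 2 v‖ := by simpa using hv
  have h1 := (Matrix.toEuclideanCLM (n := n) (𝕜 := ℝ) A).le_opNorm (WithLp.toLp 2 v)
  rw [Matrix.toEuclideanCLM_toLp, h, WithLp.toLp_smul, norm_smul] at h1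
  exact (le_abs_self l).trans (le_of_mul_le_mul_right h1 h0)

end Norms

/-! ### Convexity inequalities -/

section Inequalities

/-- The convex function `1 / y` lies above its tangent at `x`; the gap is `(y - x)² / (x² y)`. -/
theorem inv_tangent {x y : ℝ} (hx : 0 < x) (hy : 0 < y) :
    x⁻¹ - (y - x) / x ^ 2 ≤ y⁻¹ := by
  have h : y⁻¹ - (x⁻¹ - (y - x) / x ^ 2) = (y - x) ^ 2 / (x ^ 2 * y) := by
    field_simp; ring
  have : 0 ≤ (y - x) ^ 2 / (x ^ 2 * y) := by positivity
  linarith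

/-- Averages of `a / x` are bounded below by the value at the average. -/
theorem card_mul_inv_le_sum_inv {ι : Type*} [Fintype ι] {x : ι → ℝ} (hx : ∀ i, 0 < x i) {z : ℝ}
    (hz : 0 < z) (hsum : ∑ i, x i = Fintype.card ι * z) :
    (Fintype.card ι : ℝ) * z⁻¹ ≤ ∑ i, (x i)⁻¹ := by
  have h := Finset.sum_le_sum fun i (_ : i ∈ Finset.univ) => inv_tangent hz (hx i)
  rw [Finset.sum_sub_distrib, ← Finset.sum_div, Finset.sum_sub_distrib, hsum] at h
  simpa using h

/-- Squares of a nonnegative decreasing affine function of `1 / x` satisfy Jensen's inequality. -/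
theorem card_mul_sq_le_sum_sq {ι : Type*} [Fintype ι] {x : ι → ℝ} (hx : ∀ i, 0 < x i) {z : ℝ}
    (hz : 0 < z) (hsum : ∑ i, x i = Fintype.card ι * z) {a d : ℝ} (ha : 0 ≤ a)
    (hd : 0 ≤ a * z⁻¹ - d) :
    (Fintype.card ι : ℝ) * (a * z⁻¹ - d) ^ 2 ≤ ∑ i, (a * (x i)⁻¹ - d) ^ 2 := by
  have h := card_mul_inv_le_sum_inv hx hz hsum
  -- The tangent to `u ↦ u²` at the mean value `a / z - d`. Its slope is nonnegative there, so the
  -- bound for `∑ 1 / x i` applies; the individual terms `a / x i - d` may be negative.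
  have h1 : ∑ i, (2 * (a * z⁻¹ - d) * (a * (x i)⁻¹ - d) - (a * z⁻¹ - d) ^ 2) ≤
      ∑ i, (a * (x i)⁻¹ - d) ^ 2 :=
    Finset.sum_le_sum fun i _ => by nlinarith [sq_nonneg (a * (x i)⁻¹ - d - (a * z⁻¹ - d))]
  have h2 : ∑ i, (2 * (a * z⁻¹ - d) * (a * (x i)⁻¹ - d) - (a * z⁻¹ - d) ^ 2) =
      2 * (a * z⁻¹ - d) * (a * ∑ i, (x i)⁻¹ - Fintype.card ι * d)
        - Fintype.card ι * (a * z⁻¹ - d) ^ 2 := by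
    rw [Finset.sum_sub_distrib, ← Finset.mul_sum, Finset.sum_sub_distrib, ← Finset.mul_sum]
    simp
  have h3 : 0 ≤ (a * z⁻¹ - d) * a * (∑ i, (x i)⁻¹ - Fintype.card ι * z⁻¹) :=
    mul_nonneg (mul_nonneg hd ha) (by linarith)
  nlinarith

/-- In `sq_le_sum_cross` the right-hand side is the coefficient of the total deviation `S`, and `2p
+ 3β` is what is needed to absorb the negative multiple of `Q`. Homogenizing by `z w = 1` reduces it
to `t (p + 2β - z) ≥ 2β`, which is where `t ≥ 2` enters. -/
theorem sum_cross_slope {t p β z w : ℝ} (hβ : 0 < β) (ht : 2 ≤ t) (hz : 0 < z) (hzw : z * w = 1)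
    (hzp : z ≤ p + β) (hw : 0 ≤ w) :
    2 * p + 3 * β ≤ 2 * t * ((p + 2 * β) * w - 1) * (p + 2 * β) + 2 * (p + 2 * β)
      - 2 * (β * (2 * p + 3 * β)) * w := by
  have h1 : 2 * t * ((p + 2 * β) * w - 1) * (p + 2 * β) + 2 * (p + 2 * β)
      - 2 * (β * (2 * p + 3 * β)) * w = (2 * p + 3 * β) +
      w * (2 * (t * (p + 2 * β - z)) * (p + 2 * β) + β * z - 2 * (β * (2 * p + 3 * β))) := by
    linear_combination (2 * t * (p + 2 * β) - β) * hzw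
  have h2 : 2 * β ≤ t * (p + 2 * β - z) :=
    mul_le_mul ht (by linarith) hβ.le (by linarith)
  have h3 : 2 * β * (p + 2 * β) ≤ t * (p + 2 * β - z) * (p + 2 * β) :=
    mul_le_mul_of_nonneg_right h2 (by linarith)
  have h4 : 0 ≤ 2 * (t * (p + 2 * β - z)) * (p + 2 * β) + β * z - 2 * (β * (2 * p + 3 * β)) := by
    linarith [mul_pos hβ hz, mul_pos hβ hβ]
  rw [h1]
  linarith [mul_nonneg hw h4]

/-- The quadratic part of the Frobenius norm of an average of residuals in one block: it is at
least its value for samples of equal size. -/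
theorem sq_le_sum_cross {t : ℕ} (ht : 0 < t) {c : Fin t → ℝ} {p β z : ℝ} (hβ : 0 < β)
    (hc : ∀ i, 0 ≤ c i) (hcp : ∀ i, c i ≤ p) (hsum : ∑ i, c i = t * (z - β)) :
    ((t * p + (2 * t - 1) * β) * z⁻¹ - (t - 1)) ^ 2 ≤
      ∑ i, ∑ j, if i = j then ((p + β) / (c i + β)) ^ 2
        else (p + β - c i) / (c i + β) * ((p + β - c j) / (c j + β)) := by
  have htpos : (0 : ℝ) < t := by exact_mod_cast ht
  have hp : 0 ≤ p := (hc ⟨0, ht⟩).trans (hcp ⟨0, ht⟩)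
  have hzβ : β ≤ z := by
    have : 0 ≤ (t : ℝ) * (z - β) := hsum ▸ Finset.sum_nonneg fun i _ => hc i
    nlinarith [nonneg_of_mul_nonneg_right this htpos]
  have hzp : z - β ≤ p := by
    have : (t : ℝ) * (z - β) ≤ t * p := by
      rw [← hsum]; simpa using Finset.sum_le_sum fun i (_ : i ∈ Finset.univ) => hcp i
    exact le_of_mul_le_mul_left this htpos
  have hz : 0 < z := hβ.trans_le hzβ
  have hx : ∀ i, 0 < c i + β := fun i => by linarith [hc i]
  set K := p + 2 * β with hK
  set w := z⁻¹ with hw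
  have hwpos : 0 < w := inv_pos.2 hz
  have hzw : z * w = 1 := mul_inv_cancel₀ hz.ne'
  set δ : Fin t → ℝ := fun i => (c i + β)⁻¹ - w with hδ
  -- the sum of the deviations dominates the sum of their squares
  set S := ∑ i, δ i with hS
  set Q := ∑ i, δ i ^ 2 with hQ
  have hSQ : β * Q ≤ S := by
    have h1 : ∀ i, β * δ i ^ 2 ≤ δ i + (c i + β - z) * w ^ 2 := by
      intro i
      have h2 : δ i = -(c i + β - z) * (c i + β)⁻¹ * w := by
        have := (hx i).ne'
        simp only [hδ, hw]; field_simp; ring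
      -- The exact gap between `1 / x` and its tangent at `z`, for `x = c i + β ≥ β`. The linear
      -- terms cancel on summation because `z` is the mean of the `c i + β`.
      have h3 : δ i + (c i + β - z) * w ^ 2 = (c i + β) * δ i ^ 2 := by
        have := (hx i).ne'
        simp only [hδ, hw]; field_simp; ring
      rw [h3]
      exact mul_le_mul_of_nonneg_right (by linarith [hc i]) (sq_nonneg _)
    have h2 := Finset.sum_le_sum fun i (_ : i ∈ Finset.univ) => h1 i
    have h3 : ∑ i, (c i + β - z) = 0 := by
      rw [Finset.sum_sub_distrib, Finset.sum_add_distrib, hsum]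
      simp only [Finset.sum_const, Finset.card_univ, Fintype.card_fin, nsmul_eq_mul]
      ring
    rw [← Finset.mul_sum, Finset.sum_add_distrib, ← Finset.sum_mul, h3] at h2
    linarith
  have hQ0 : 0 ≤ Q := Finset.sum_nonneg fun i _ => sq_nonneg _
  have hS0 : 0 ≤ S := (mul_nonneg hβ.le hQ0).trans hSQ
  have hf : ∀ i, (p + β - c i) / (c i + β) = (K * w - 1) + K * δ i := by
    intro i
    have := (hx i).ne'
    simp only [hδ, hK]; field_simp; ring
  have hg : ∀ i, ((p + β) / (c i + β)) ^ 2 = ((p + β) * (w + δ i)) ^ 2 := by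
    intro i
    simp only [hδ, div_eq_mul_inv]; ring
  -- Extending the off-diagonal formula to all pairs gives a perfect square; the remainder is the
  -- diagonal correction, quadratic in `δ i`, hence expressed by `S` and `Q`.
  have hsplit : (∑ i, ∑ j, if i = j then ((p + β) / (c i + β)) ^ 2
        else (p + β - c i) / (c i + β) * ((p + β - c j) / (c j + β))) =
      (t * (K * w - 1) + K * S) ^ 2 + (t * (-(K ^ 2 - (p + β) ^ 2) * w ^ 2 + 2 * K * w - 1) +
        (2 * K - 2 * (K ^ 2 - (p + β) ^ 2) * w) * S - (K ^ 2 - (p + β) ^ 2) * Q) := by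
    have h1 : ∀ i j : Fin t, (if i = j then ((p + β) / (c i + β)) ^ 2
        else (p + β - c i) / (c i + β) * ((p + β - c j) / (c j + β))) =
        ((K * w - 1) + K * δ i) * ((K * w - 1) + K * δ j) +
        if i = j then ((-(K ^ 2 - (p + β) ^ 2) * w ^ 2 + 2 * K * w - 1) +
        (2 * K - 2 * (K ^ 2 - (p + β) ^ 2) * w) * δ i - (K ^ 2 - (p + β) ^ 2) * δ i ^ 2) else 0 := by
      intro i j
      split_ifs with h
      · subst h; rw [hg]; ring
      · rw [hf, hf]; ring
    simp only [h1, Finset.sum_add_distrib, Finset.sum_ite_eq, Finset.mem_univ, if_true]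
    rw [← Finset.sum_mul_sum, ← sq]
    simp only [Finset.sum_add_distrib, Finset.sum_sub_distrib, ← Finset.mul_sum, ← hS, ← hQ,
      Finset.sum_const, Finset.card_univ, Fintype.card_fin, nsmul_eq_mul]
    ring
  rw [hsplit]
  have hlhs : (t * p + (2 * t - 1) * β) * w - (t - 1) =
      t * (K * w - 1) - β * w + 1 := by rw [hK]; ring
  rw [hlhs]
  have hKP : K ^ 2 - (p + β) ^ 2 = β * (2 * p + 3 * β) := by rw [hK]; ring
  rw [hKP]
  -- the value for equal sizes is a convex combination of squares
  have hequal : (t * (K * w - 1) - β * w + 1) ^ 2 ≤ (t * (K * w - 1)) ^ 2 +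
      t * (-(β * (2 * p + 3 * β)) * w ^ 2 + 2 * K * w - 1) := by
    have ht1 : (1 : ℝ) ≤ t := by exact_mod_cast ht
    -- After this factorization the two sides differ by exactly `(t - 1) (1 - β w)²`. Giving up this
    -- term leaves a perfect square, the form needed for averaging over blocks.
    have h1 : -(β * (2 * p + 3 * β)) * w ^ 2 + 2 * K * w - 1 =
        (1 - β * w) * (2 * (K * w - 1) + (1 - β * w)) := by rw [hK]; ring
    rw [h1]
    nlinarith [mul_nonneg (sub_nonneg.2 ht1) (sq_nonneg (1 - β * w))]
  -- For `t = 1` the only count is its own mean, so all deviations vanish; otherwise the slope bound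
  -- applies and `β Q ≤ S` pays for the term in `Q`.
  have hslope : (2 * p + 3 * β) ≤ 2 * t * (K * w - 1) * K + 2 * K
      - 2 * (β * (2 * p + 3 * β)) * w ∨ Q = 0 ∧ S = 0 := by
    rcases (show t = 1 ∨ 2 ≤ t by omega) with rfl | ht2
    · right
      have h0 : δ 0 = 0 := by
        simp only [Fin.sum_univ_one, Nat.cast_one, one_mul] at hsum
        simp only [hδ, hw, hsum]
        simp
      constructor
      · simp [hQ, h0]
      · simp [hS, h0]
    · left
      have ht2' : (2 : ℝ) ≤ t := by exact_mod_cast ht2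
      exact sum_cross_slope hβ ht2' hz hzw (by linarith) hwpos.le
  rcases hslope with hslope | ⟨hQ', hS'⟩
  · nlinarith [mul_le_mul_of_nonneg_right hslope hS0, mul_nonneg (sq_nonneg K) (sq_nonneg S),
      mul_le_mul_of_nonneg_left hSQ (by positivity : 0 ≤ 2 * p + 3 * β)]
  · rw [hQ', hS']
    linarith

end Inequalities

/-! ### Residuals of the Nyström approximation of block matrices -/

section Residual

/-- If `W Z = Cᵀ`, then the Nyström approximation `C W† Cᵀ` is `C Z`. -/
theorem nystrom_eq_mul_of_mul_eq {n : Type*} {c : ℕ} {A : Matrix n n ℝ} (hA : Aᵀ = A)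
    (s : Fin c ↪ n) {Z : Matrix (Fin c) n ℝ}
    (hZ : A.submatrix s s * Z = (A.submatrix id s)ᵀ) : nystrom A s = A.submatrix id s * Z := by
  have hW : (A.submatrix s s)ᵀ = A.submatrix s s := by
    rw [Matrix.transpose_submatrix, hA]
  -- By symmetry `C = Zᵀ W`, so only `W W† W = W` is used and the pseudoinverse never has to be
  -- computed.
  have hC : A.submatrix id s = Zᵀ * A.submatrix s s := by
    rw [← Matrix.transpose_transpose (A.submatrix id s), ← hZ, Matrix.transpose_mul, hW]
  have hP : A.submatrix s s * pinv (A.submatrix s s) * A.submatrix s s = A.submatrix s s :=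
    (exists_isMoorePenrose (A.submatrix s s)).choose_spec.1
  rw [nystrom, ← hZ]
  calc _ = Zᵀ * (A.submatrix s s * pinv (A.submatrix s s) * A.submatrix s s) * Z := by
        rw [hC]; simp only [Matrix.mul_assoc]
    _ = _ := by rw [hP, ← hC]

variable {n κ : Type*} [DecidableEq κ]

/-- The number of sampled indices in a block. -/
def blockCount {c : ℕ} (π : n → κ) (s : Fin c ↪ n) (b : κ) : ℝ :=
  ∑ j, if π (s j) = b then 1 else 0

theorem blockCount_nonneg {c : ℕ} (π : n → κ) (s : Fin c ↪ n) (b : κ) :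
    0 ≤ blockCount π s b :=
  Finset.sum_nonneg fun _ _ => by split_ifs <;> simp

theorem sum_blockCount [Fintype κ] {c : ℕ} (π : n → κ) (s : Fin c ↪ n) :
    ∑ b, blockCount π s b = c := by
  unfold blockCount
  rw [Finset.sum_comm]
  simp

variable [DecidableEq n]

/-- The matrix `(1 - α) I + α J`, where `J` is the indicator of the partition of the indices given
by the fibres of `π`. -/
def partMat (π : n → κ) (α : ℝ) : Matrix n n ℝ :=
  Matrix.of fun x y => (if x = y then 1 - α else 0) + if π x = π y then α else 0

/-- The indicator of the indices that are not sampled. -/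
def unsampled {c : ℕ} (s : Fin c ↪ n) (x : n) : ℝ :=
  if ∃ j, s j = x then 0 else 1

theorem unsampled_mul_self {c : ℕ} (s : Fin c ↪ n) (x : n) :
    unsampled s x * unsampled s x = unsampled s x := by
  unfold unsampled; split_ifs <;> simp

theorem unsampled_mul_of_disjoint {c : ℕ} {s r : Fin c ↪ n}
    (h : Disjoint (Set.range s) (Set.range r)) (x : n) :
    unsampled s x * unsampled r x = unsampled s x + unsampled r x - 1 := by
  unfold unsampled
  split_ifs with h1 h2 <;> simp
  exact Set.disjoint_left.1 h h1 h2

theorem sum_ite_exists_eq {c : ℕ} (s : Fin c ↪ n) (x : n) :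
    (∑ j, if s j = x then (1 : ℝ) else 0) = 1 - unsampled s x := by
  unfold unsampled
  split_ifs with h
  · obtain ⟨i, rfl⟩ := h
    simp
  · push Not at h
    simp [h]

theorem sum_unsampled_fiber [Fintype n] {c p : ℕ} {π : n → κ} {b : κ}
    (hp : (Finset.univ.filter fun x => π x = b).card = p) (s : Fin c ↪ n) :
    ∑ x with π x = b, unsampled s x = p - blockCount π s b := by
  have h : ∀ x, unsampled s x = 1 - ∑ j, if s j = x then (1 : ℝ) else 0 := fun x => by
    rw [sum_ite_exists_eq]; ring
  simp only [h, Finset.sum_sub_distrib]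
  rw [Finset.sum_comm]
  simp [hp, blockCount]

theorem blockCount_le [Fintype n] {c p : ℕ} {π : n → κ} {b : κ}
    (hp : (Finset.univ.filter fun x => π x = b).card = p) (s : Fin c ↪ n) :
    blockCount π s b ≤ p := by
  rw [← sub_nonneg, ← sum_unsampled_fiber hp s]
  exact Finset.sum_nonneg fun x _ => by unfold unsampled; split_ifs <;> simp

theorem partMat_transpose (π : n → κ) (α : ℝ) : (partMat π α)ᵀ = partMat π α := by
  ext x y
  simp [partMat, eq_comm]

/-- The coefficient of the rank-one part of the residual in a block with `g` samples. -/
def residualCoeff (α g : ℝ) : ℝ := α / (1 - α + α * g)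

theorem residualCoeff_eq {α g : ℝ} (h0 : 0 < α) :
    residualCoeff α g = 1 / (g + (1 - α) / α) := by
  unfold residualCoeff
  rw [show g + (1 - α) / α = (1 - α + α * g) / α by field_simp; ring, one_div_div]

theorem residualCoeff_nonneg {α g : ℝ} (h0 : 0 ≤ α) (h1 : α ≤ 1) (hg : 0 ≤ g) :
    0 ≤ residualCoeff α g :=
  div_nonneg h0 (by have := mul_nonneg h0 hg; linarith)

/-- Let `1_b` be the indicator of the sampled indices in block `b`. Then `W 1_b = (1 - α + α c_b)
1_b`, while the column of `Cᵀ` at an unsampled index of `b` is `α 1_b`. Hence `W Z = Cᵀ` is solved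
by the multiple `residualCoeff` of `1_b` at that column, and by a unit vector at a sampled column.
-/
theorem sub_nystrom_partMat {c : ℕ} (π : n → κ) {α : ℝ} (h0 : 0 ≤ α) (h1 : α < 1)
    (s : Fin c ↪ n) (x y : n) :
    (partMat π α - nystrom (partMat π α) s) x y =
      (1 - α) * (unsampled s x * unsampled s y * ((if x = y then 1 else 0) +
        if π x = π y then residualCoeff α (blockCount π s (π x)) else 0)) := by
  set Z : Matrix (Fin c) n ℝ := Matrix.of fun j y => (if s j = y then 1 else 0) +
    unsampled s y * if π (s j) = π y then residualCoeff α (blockCount π s (π y)) else 0 with hZ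
  have hpos : ∀ b, 0 < 1 - α + α * blockCount π s b := fun b => by
    have := mul_nonneg h0 (blockCount_nonneg π s b); linarith
  -- All rows `x` are treated at once: sampled rows verify `W Z = Cᵀ`, and the full product then
  -- gives the residual.
  have hCZ : ∀ x y, ((partMat π α).submatrix id s * Z) x y = partMat π α x y * (1 - unsampled s y) +
      unsampled s y * if π x = π y then residualCoeff α (blockCount π s (π y)) *
        ((1 - α) * (1 - unsampled s x) + α * blockCount π s (π y)) else 0 := by
    intro x y
    have hA : ∀ j, (partMat π α).submatrix id s x j * Z j y =
        partMat π α x y * (if s j = y then 1 else 0) +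
        unsampled s y * if π x = π y then residualCoeff α (blockCount π s (π y)) *
          ((1 - α) * (if s j = x then 1 else 0) + α * if π (s j) = π y then 1 else 0) else 0 := by
      intro j
      simp only [hZ, partMat, Matrix.submatrix_apply, Matrix.of_apply, id]
      by_cases e1 : s j = y
      · subst e1
        have : unsampled s (s j) = 0 := if_pos ⟨j, rfl⟩
        simp [this]
      · by_cases e2 : s j = x
        · subst e2
          by_cases e3 : π (s j) = π y <;> simp [e1, e3]
        · have e2' : ¬ x = s j := fun h => e2 h.symm
          by_cases e3 : π (s j) = π y
          · simp [e1, e2, e2', e3]; split_ifs <;> ring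
          · by_cases e4 : π x = π y
            · simp [e1, e2, e2', e3, e4]
            · simp [e1, e2', e3, e4]
    rw [Matrix.mul_apply, Finset.sum_congr rfl fun j _ => hA j, Finset.sum_add_distrib,
      ← Finset.mul_sum, ← Finset.mul_sum, sum_ite_exists_eq]
    congr 2
    split_ifs
    · rw [← Finset.mul_sum, Finset.sum_add_distrib, ← Finset.mul_sum, ← Finset.mul_sum,
        sum_ite_exists_eq, blockCount]
    · simp
  have hsamp : ∀ i, unsampled s (s i) = 0 := fun i => if_pos ⟨i, rfl⟩
  have hWZ : (partMat π α).submatrix s s * Z = ((partMat π α).submatrix id s)ᵀ := by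
    ext i y
    have h2 : ((partMat π α).submatrix s s * Z) i y =
        ((partMat π α).submatrix id s * Z) (s i) y := rfl
    rw [h2, hCZ, Matrix.transpose_submatrix, partMat_transpose, Matrix.submatrix_apply, id, hsamp]
    by_cases hy : ∃ j, s j = y
    · have : unsampled s y = 0 := if_pos hy
      simp [this]
    · have e : ¬ s i = y := fun h => hy ⟨i, h⟩
      have : unsampled s y = 1 := if_neg hy
      simp only [this, partMat, Matrix.of_apply, e, if_false]
      split_ifs
      · have := (hpos (π y)).ne'
        unfold residualCoeff
        field_simp; ring
      · simp
  rw [Matrix.sub_apply, nystrom_eq_mul_of_mul_eq (partMat_transpose π α) s hWZ, hCZ]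
  by_cases hxy : π x = π y
  · have h := (hpos (π y)).ne'
    have hr : residualCoeff α (blockCount π s (π y)) * (1 - α + α * blockCount π s (π y)) = α := by
      unfold residualCoeff; field_simp
    by_cases hx : x = y
    · subst hx
      simp only [partMat, Matrix.of_apply, if_true]
      linear_combination (-unsampled s x) * hr - (1 - α) * unsampled_mul_self s x
    · simp only [partMat, Matrix.of_apply, hx, hxy, if_true, if_false]
      linear_combination (-unsampled s y) * hr
  · have hx : x ≠ y := fun h => hxy (h ▸ rfl)
    simp [partMat, hx, hxy]

/-- The residual is a nonnegative diagonal matrix plus a Gram matrix with one row per block, up to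
the factor `1 - α`. Positivity survives averaging, so ensemble nuclear norms are traces. -/
theorem sub_nystrom_partMat_posSemidef [Fintype n] [Fintype κ] {c : ℕ} (π : n → κ) {α : ℝ}
    (h0 : 0 ≤ α) (h1 : α < 1) (s : Fin c ↪ n) :
    (partMat π α - nystrom (partMat π α) s).PosSemidef := by
  set M : Matrix κ n ℝ := Matrix.of fun b x =>
    if π x = b then √(residualCoeff α (blockCount π s b)) * unsampled s x else 0 with hM
  have h : partMat π α - nystrom (partMat π α) s =
      (1 - α) • (diagonal (unsampled s) + Mᴴ * M) := by
    ext x y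
    rw [sub_nystrom_partMat π h0 h1]
    have h2 : (Mᴴ * M) x y = if π x = π y then
        residualCoeff α (blockCount π s (π x)) * (unsampled s x * unsampled s y) else 0 := by
      rw [Matrix.mul_apply]
      simp only [hM, Matrix.conjTranspose_apply, Matrix.of_apply, star_trivial]
      rw [Finset.sum_eq_single (π x)]
      · have := Real.mul_self_sqrt (residualCoeff_nonneg h0 h1.le (blockCount_nonneg π s (π x)))
        by_cases hxy : π x = π y
        · simp only [hxy, if_true] at this ⊢
          linear_combination (unsampled s x * unsampled s y) * this
        · have : ¬ π y = π x := fun h => hxy h.symm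
          simp [hxy, this]
      · intro b _ hb
        simp [hb.symm]
      · simp
    rw [Matrix.smul_apply, Matrix.add_apply, h2, Matrix.diagonal_apply, smul_eq_mul]
    by_cases hx : x = y
    · subst hx
      simp only [if_true]
      linear_combination (1 - α) * unsampled_mul_self s x
    · simp only [hx, if_false]
      split_ifs <;> ring
  rw [h]
  refine Matrix.PosSemidef.smul (Matrix.PosSemidef.add ?_ ?_) (by linarith)
  · refine Matrix.posSemidef_diagonal_iff.2 fun x => ?_
    unfold unsampled; split_ifs <;> simp
  · exact Matrix.posSemidef_conjTranspose_mul_self M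

/-- With no sampled columns the Nyström approximation is zero and the residual is the matrix itself.
-/
theorem partMat_posSemidef [Fintype n] [Fintype κ] (π : n → κ) {α : ℝ} (h0 : 0 ≤ α)
    (h1 : α < 1) : (partMat π α).PosSemidef := by
  have h := sub_nystrom_partMat_posSemidef π h0 h1 (Function.Embedding.ofIsEmpty : Fin 0 ↪ n)
  have h2 : nystrom (partMat π α) (Function.Embedding.ofIsEmpty : Fin 0 ↪ n) = 0 := by
    ext x y
    simp [nystrom, Matrix.mul_apply]
  rwa [h2, sub_zero] at h

end Residual

/-! ### Norms of the residuals -/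

section ResidualNorms

theorem sum_eq_sum_fiber {n κ : Type*} [Fintype n] [Fintype κ] [DecidableEq κ] (π : n → κ) (f : n → ℝ) (g : κ → ℝ) :
    ∑ x, f x * g (π x) = ∑ b, (∑ x with π x = b, f x) * g b := by
  rw [← Finset.sum_fiberwise (s := Finset.univ) (g := π)]
  refine Finset.sum_congr rfl fun b _ => ?_
  rw [Finset.sum_mul]
  exact Finset.sum_congr rfl fun x hx => by rw [(Finset.mem_filter.1 hx).2]

theorem sum_sum_sq_sum {ι l o : Type*} [Fintype ι] [Fintype l] [Fintype o] (f : ι → l → o → ℝ) :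
    ∑ x, ∑ y, (∑ i, f i x y) ^ 2 = ∑ i, ∑ j, ∑ x, ∑ y, f i x y * f j x y := by
  calc _ = ∑ x, ∑ y, ∑ i, ∑ j, f i x y * f j x y := by simp only [sq, Finset.sum_mul_sum]
    _ = ∑ x, ∑ i, ∑ j, ∑ y, f i x y * f j x y := by
      refine Finset.sum_congr rfl fun x _ => ?_
      rw [Finset.sum_comm]
      exact Finset.sum_congr rfl fun i _ => Finset.sum_comm
    _ = _ := by
      rw [Finset.sum_comm]
      exact Finset.sum_congr rfl fun i _ => Finset.sum_comm

theorem sub_ensemble {t c : ℕ} (ht : 0 < t) {n : Type*} (A : Matrix n n ℝ) (s : Fin t → (Fin c ↪ n)) :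
    A - ensemble (fun _ => 1 / (t : ℝ)) A s = (1 / (t : ℝ)) • ∑ i, (A - nystrom A (s i)) := by
  have ht' : (t : ℝ) ≠ 0 := by exact_mod_cast ht.ne'
  rw [ensemble, Finset.sum_sub_distrib, smul_sub, ← Finset.smul_sum]
  congr 1
  rw [Finset.sum_const, Finset.card_univ, Fintype.card_fin, ← Nat.cast_smul_eq_nsmul ℝ, smul_smul,
    one_div, inv_mul_cancel₀ ht', one_smul]

variable {n κ : Type*} [Fintype n] [DecidableEq n] [Fintype κ] [DecidableEq κ]

/-- The Frobenius inner product of two residuals. -/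
theorem sum_sub_nystrom_mul {c : ℕ} (π : n → κ) {α : ℝ} (h0 : 0 ≤ α) (h1 : α < 1)
    (s r : Fin c ↪ n) :
    ∑ x, ∑ y, (partMat π α - nystrom (partMat π α) s) x y *
        (partMat π α - nystrom (partMat π α) r) x y =
      (1 - α) ^ 2 * ∑ b, ((1 + residualCoeff α (blockCount π s b) *
          ∑ x with π x = b, unsampled s x * unsampled r x) *
        (1 + residualCoeff α (blockCount π r b) *
          ∑ x with π x = b, unsampled s x * unsampled r x) +
        ∑ x with π x = b, unsampled s x * unsampled r x - 1) := by
  set w : n → ℝ := fun x => unsampled s x * unsampled r x with hw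
  set η := fun b => residualCoeff α (blockCount π s b) with hη
  set θ := fun b => residualCoeff α (blockCount π r b) with hθ
  have hww : ∀ x, w x * w x = w x := fun x => by
    simp only [hw]
    linear_combination unsampled r x * unsampled r x * unsampled_mul_self s x +
      unsampled s x * unsampled_mul_self r x
  -- Both residuals follow the same block pattern, and `w` is the indicator of the commonly
  -- unsampled indices. A block with `n` of these contributes `n (1 + η + θ) + n² η θ`.
  have h : ∀ x y, (partMat π α - nystrom (partMat π α) s) x y *
        (partMat π α - nystrom (partMat π α) r) x y =
      (1 - α) ^ 2 * ((if x = y then w x * (1 + η (π x) + θ (π x)) else 0) +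
        if π y = π x then w y * (w x * (η (π x) * θ (π x))) else 0) := by
    intro x y
    rw [sub_nystrom_partMat π h0 h1, sub_nystrom_partMat π h0 h1]
    change (1 - α) * (_ * (_ + if π x = π y then η (π x) else 0)) *
      ((1 - α) * (_ * (_ + if π x = π y then θ (π x) else 0))) = _
    have hxy : (1 - α) * (unsampled s x * unsampled s y * ((if x = y then 1 else 0) +
        if π x = π y then η (π x) else 0)) * ((1 - α) * (unsampled r x * unsampled r y *
        ((if x = y then 1 else 0) + if π x = π y then θ (π x) else 0))) =
        (1 - α) ^ 2 * (w x * w y * (((if x = y then 1 else 0) +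
        if π x = π y then η (π x) else 0) * ((if x = y then 1 else 0) +
        if π x = π y then θ (π x) else 0))) := by simp only [hw]; ring
    rw [hxy]
    by_cases e : x = y
    · subst e
      simp only [if_true]
      rw [hww]
      linear_combination -((1 - α) ^ 2 * (η (π x) * θ (π x))) * hww x
    · by_cases e2 : π x = π y
      · simp [e, e2]; ring_nf; simp
      · have e3 : ¬ π y = π x := fun h => e2 h.symm
        simp [e, e2, e3]
  simp only [h, ← Finset.mul_sum, Finset.sum_add_distrib, Finset.sum_ite_eq, Finset.mem_univ,
    if_true]
  congr 1
  have h2 : ∀ x, (∑ y, if π y = π x then w y * (w x * (η (π x) * θ (π x))) else 0) =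
      w x * ((∑ y with π y = π x, w y) * (η (π x) * θ (π x))) := by
    intro x
    rw [← Finset.sum_filter, ← Finset.sum_mul]; ring
  simp only [h2]
  rw [sum_eq_sum_fiber π w fun b => 1 + η b + θ b,
    sum_eq_sum_fiber π w fun b => (∑ y with π y = b, w y) * (η b * θ b), ← Finset.sum_add_distrib]
  refine Finset.sum_congr rfl fun b _ => ?_
  ring

theorem trace_sub_nystrom {c p : ℕ} {π : n → κ}
    (hp : ∀ b, (Finset.univ.filter fun x => π x = b).card = p) {α : ℝ} (h0 : 0 ≤ α) (h1 : α < 1)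
    (s : Fin c ↪ n) :
    (partMat π α - nystrom (partMat π α) s).trace =
      (1 - α) * ∑ b, (p - blockCount π s b) * (1 + residualCoeff α (blockCount π s b)) := by
  rw [Matrix.trace]
  simp only [Matrix.diag_apply, sub_nystrom_partMat π h0 h1, if_true, unsampled_mul_self,
    ← Finset.mul_sum]
  rw [sum_eq_sum_fiber π (unsampled s) fun b => 1 + residualCoeff α (blockCount π s b)]
  simp only [sum_unsampled_fiber (hp _)]

/-- With `x = c_b + β`, each block contributes `(p + β - 1) - x + (p + β) / x` to a trace. The sum
of the `x` is fixed, so only the convex term varies. The bound holds for each sample separately, so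
disjointness plays no role. -/
theorem nucNorm_sub_ensemble_ge {t c p : ℕ} (ht : 0 < t) {π : n → κ} [Nonempty κ]
    (hp : ∀ b, (Finset.univ.filter fun x => π x = b).card = p) {α : ℝ} (h0 : 0 < α) (h1 : α < 1)
    (s : Fin t → (Fin c ↪ n)) {m k : ℝ} (hk : k = Fintype.card κ) (hm : m = k * p) :
    (1 - α) * ((m - c) * (1 + k / (c + (1 - α) / α * k))) ≤
      nucNorm (partMat π α - ensemble (fun _ => 1 / (t : ℝ)) (partMat π α) s) := by
  have ht' : (0 : ℝ) < t := by exact_mod_cast ht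
  have hkpos : 0 < k := by rw [hk]; exact_mod_cast Fintype.card_pos
  set β := (1 - α) / α with hβ
  have hβpos : 0 < β := div_pos (by linarith) h0
  have hc : (0 : ℝ) ≤ c := Nat.cast_nonneg c
  rw [hm]
  have hpsd : (partMat π α - ensemble (fun _ => 1 / (t : ℝ)) (partMat π α) s).PosSemidef := by
    rw [sub_ensemble ht]
    refine Matrix.PosSemidef.smul (Matrix.posSemidef_sum _ fun i _ => ?_) (by positivity)
    exact sub_nystrom_partMat_posSemidef π h0.le h1 (s i)
  rw [nucNorm_eq_trace hpsd, sub_ensemble ht, Matrix.trace_smul, Matrix.trace_sum]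
  have key : ∀ i, (1 - α) * ((k * p - c) * (1 + k / (c + β * k))) ≤
      (partMat π α - nystrom (partMat π α) (s i)).trace := by
    intro i
    rw [trace_sub_nystrom hp h0.le h1]
    refine mul_le_mul_of_nonneg_left ?_ (by linarith)
    have hx : ∀ b, 0 < blockCount π (s i) b + β := fun b => by
      linarith [blockCount_nonneg π (s i) b]
    have hz : 0 < c / k + β := by positivity
    have hsum : ∑ b, (blockCount π (s i) b + β) = Fintype.card κ * (c / k + β) := by
      rw [Finset.sum_add_distrib, sum_blockCount]
      simp only [Finset.sum_const, Finset.card_univ, nsmul_eq_mul, ← hk]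
      field_simp
    have h := card_mul_inv_le_sum_inv hx hz hsum
    rw [← hk] at h hsum
    have h2 : ∀ b, (p - blockCount π (s i) b) * (1 + residualCoeff α (blockCount π (s i) b)) =
        (p + β - 1) - (blockCount π (s i) b + β) + (p + β) * (blockCount π (s i) b + β)⁻¹ := by
      intro b
      rw [residualCoeff_eq h0, ← hβ]
      have := (hx b).ne'
      field_simp; ring
    rw [Finset.sum_congr rfl fun b _ => h2 b, Finset.sum_add_distrib, Finset.sum_sub_distrib,
      ← Finset.mul_sum, hsum]
    simp only [Finset.sum_const, Finset.card_univ, nsmul_eq_mul, ← hk]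
    have h3 : (k * p - c) * (1 + k / (c + β * k)) =
        k * (p + β - 1) - k * (c / k + β) + (p + β) * (k * (c / k + β)⁻¹) := by
      have : c + β * k ≠ 0 := by positivity
      have e : (c / k + β)⁻¹ = k / (c + β * k) := by
        field_simp
      rw [e]; field_simp; ring
    rw [h3]
    have := mul_le_mul_of_nonneg_left h (by positivity : 0 ≤ p + β)
    linarith
  have h := Finset.sum_le_sum fun i (_ : i ∈ Finset.univ) => key i
  rw [Finset.sum_const, Finset.card_univ, Fintype.card_fin, nsmul_eq_mul] at h
  rw [smul_eq_mul, one_div, ← div_eq_inv_mul, le_div_iff₀ ht']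
  linarith

theorem frobNorm_sub_ensemble_ge {t c p : ℕ} (ht : 0 < t) {π : n → κ} [Nonempty κ]
    (hp : ∀ b, (Finset.univ.filter fun x => π x = b).card = p) {α : ℝ} (h0 : 0 < α) (h1 : α < 1)
    {s : Fin t → (Fin c ↪ n)} (hs : NonOverlapping s) {m k : ℝ} (hk : k = Fintype.card κ)
    (hm : m = k * p) :
    (1 - α) * √((m - 2 * c + c / t - k) +
        k * ((m - c + c / t + (1 - α) / α * k) / (c + (1 - α) / α * k)) ^ 2) ≤
      frobNorm (partMat π α - ensemble (fun _ => 1 / (t : ℝ)) (partMat π α) s) := by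
  have ht' : (0 : ℝ) < t := by exact_mod_cast ht
  have hkpos : 0 < k := by rw [hk]; exact_mod_cast Fintype.card_pos
  set β := (1 - α) / α with hβ
  have hβpos : 0 < β := div_pos (by linarith) h0
  have hc : (0 : ℝ) ≤ c := Nat.cast_nonneg c
  have hx : ∀ i b, 0 < blockCount π (s i) b + β := fun i b => by
    linarith [blockCount_nonneg π (s i) b]
  set E : κ → ℝ := fun b => ∑ i, ∑ j, if i = j then ((p + β) / (blockCount π (s i) b + β)) ^ 2
    else (p + β - blockCount π (s i) b) / (blockCount π (s i) b + β) *
      ((p + β - blockCount π (s j) b) / (blockCount π (s j) b + β)) with hE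
  have hinner : ∀ i j, ∑ x, ∑ y, (partMat π α - nystrom (partMat π α) (s i)) x y *
        (partMat π α - nystrom (partMat π α) (s j)) x y =
      (1 - α) ^ 2 * ((∑ b, if i = j then ((p + β) / (blockCount π (s i) b + β)) ^ 2
    else (p + β - blockCount π (s i) b) / (blockCount π (s i) b + β) *
      ((p + β - blockCount π (s j) b) / (blockCount π (s j) b + β))) +
      ((m - 2 * c - k) + if i = j then (c : ℝ) else 0)) := by
    intro i j
    rw [sum_sub_nystrom_mul π h0.le h1]
    congr 1
    -- The part of the inner product independent of how samples are spread over blocks. Averaged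
    -- over the `t²` pairs, the extra `c` on the diagonal becomes `c / t`.
    have hconst : (m - 2 * c - k) + (if i = j then (c : ℝ) else 0) =
        ∑ b, ((p : ℝ) - blockCount π (s i) b - blockCount π (s j) b +
          (if i = j then blockCount π (s i) b else 0) - 1) := by
      rw [Finset.sum_sub_distrib, Finset.sum_add_distrib, Finset.sum_sub_distrib,
        Finset.sum_sub_distrib, sum_blockCount, sum_blockCount]
      split_ifs
      · rw [sum_blockCount]
        simp [← hk, ← hm]; ring
      · simp [← hk, ← hm]; ring
    rw [hconst, ← Finset.sum_add_distrib]
    refine Finset.sum_congr rfl fun b _ => ?_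
    rw [residualCoeff_eq h0, residualCoeff_eq h0, ← hβ]
    have hi := (hx i b).ne'
    have hj := (hx j b).ne'
    by_cases e : i = j
    · subst e
      simp only [unsampled_mul_self, sum_unsampled_fiber (hp _), if_true]
      field_simp; ring
    -- Disjoint samples leave `p - c_i - c_j` common unsampled indices in the block. The factors are
    -- then `(p + β - c_j) / (c_i + β)` and `(p + β - c_i) / (c_j + β)`; exchanging numerators
    -- separates the two samples.
    · simp only [unsampled_mul_of_disjoint (hs e), Finset.sum_sub_distrib, Finset.sum_add_distrib,
        sum_unsampled_fiber (hp _), e, if_false]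
      simp only [Finset.sum_const, hp, nsmul_eq_mul]
      field_simp; ring
  have hfrob : ∑ x, ∑ y, (partMat π α - ensemble (fun _ => 1 / (t : ℝ)) (partMat π α) s) x y ^ 2 =
      (1 - α) ^ 2 * ((1 / t) ^ 2 * ∑ b, E b + (m - 2 * c + c / t - k)) := by
    have h : ∀ x y, (partMat π α - ensemble (fun _ => 1 / (t : ℝ)) (partMat π α) s) x y ^ 2 =
        (1 / t) ^ 2 * (∑ i, (partMat π α - nystrom (partMat π α) (s i)) x y) ^ 2 := by
      intro x y
      rw [sub_ensemble ht, Matrix.smul_apply, Matrix.sum_apply, smul_eq_mul, mul_pow]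
    simp only [h]
    simp only [← Finset.mul_sum]
    rw [sum_sum_sq_sum fun i x y => (partMat π α - nystrom (partMat π α) (s i)) x y]
    simp only [hinner, ← Finset.mul_sum, Finset.sum_add_distrib, Finset.sum_ite_eq,
      Finset.mem_univ, if_true, Finset.sum_const, Finset.card_univ, Fintype.card_fin, nsmul_eq_mul]
    have hE' : ∑ b, E b = ∑ i, ∑ j, ∑ b, if i = j then ((p + β) / (blockCount π (s i) b + β)) ^ 2
        else (p + β - blockCount π (s i) b) / (blockCount π (s i) b + β) *
        ((p + β - blockCount π (s j) b) / (blockCount π (s j) b + β)) := by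
      simp only [hE]
      rw [Finset.sum_comm]
      exact Finset.sum_congr rfl fun i _ => Finset.sum_comm
    rw [hE']
    field_simp; ring
  have hEb : ∑ b, E b ≥
      t ^ 2 * (k * ((m - c + c / t + β * k) / (c + β * k)) ^ 2) := by
    set z : κ → ℝ := fun b => (∑ i, blockCount π (s i) b) / t + β with hz
    have hzpos : ∀ b, 0 < z b := fun b => by
      have : 0 ≤ ∑ i, blockCount π (s i) b :=
        Finset.sum_nonneg fun i _ => blockCount_nonneg π (s i) b
      positivity
    have h1 : ∀ b, ((t * p + (2 * t - 1) * β) * (z b)⁻¹ - (t - 1)) ^ 2 ≤ E b := fun b =>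
      sq_le_sum_cross ht hβpos (fun i => blockCount_nonneg π (s i) b)
        (fun i => blockCount_le (hp b) (s i)) (by simp only [hz]; field_simp; ring)
    have hZ : 0 < c / k + β := by positivity
    have hzsum : ∑ b, z b = Fintype.card κ * (c / k + β) := by
      simp only [hz]
      rw [Finset.sum_add_distrib, ← Finset.sum_div, Finset.sum_comm]
      simp only [sum_blockCount, Finset.sum_const, Finset.card_univ, nsmul_eq_mul,
        Fintype.card_fin, ← hk]
      field_simp
    have ht1 : (1 : ℝ) ≤ t := by exact_mod_cast ht
    -- Needed for the affine function of `1 / z` to be nonnegative at the mean.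
    have hcm : (c : ℝ) ≤ m := by
      rw [hm, hk, ← sum_blockCount π (s ⟨0, ht⟩)]
      simpa using Finset.sum_le_sum fun b (_ : b ∈ Finset.univ) => blockCount_le (hp b) (s ⟨0, ht⟩)
    have hval : (t * p + (2 * t - 1) * β) * (c / k + β)⁻¹ - (t - 1) =
        t * ((m - c + c / t + β * k) / (c + β * k)) := by
      have : c + β * k ≠ 0 := by positivity
      have e : (c / k + β)⁻¹ = k / (c + β * k) := by field_simp
      rw [e, hm]; field_simp; ring
    have h2 := card_mul_sq_le_sum_sq hzpos hZ hzsum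
      (a := t * p + (2 * t - 1) * β) (d := t - 1)
      (by have : 0 ≤ (2 * t - 1) * β := mul_nonneg (by linarith) hβpos.le
          positivity)
      (by rw [hval]
          have : 0 ≤ m - c := by linarith
          positivity)
    rw [hval, ← hk] at h2
    calc t ^ 2 * (k * ((m - c + c / t + β * k) / (c + β * k)) ^ 2) =
        k * (t * ((m - c + c / t + β * k) / (c + β * k))) ^ 2 := by ring
      _ ≤ _ := h2
      _ ≤ _ := Finset.sum_le_sum fun b _ => h1 b
  have hfinal : (1 - α) * √((m - 2 * c + c / t - k) +
        k * ((m - c + c / t + β * k) / (c + β * k)) ^ 2) =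
      √((1 - α) ^ 2 * ((m - 2 * c + c / t - k) +
        k * ((m - c + c / t + β * k) / (c + β * k)) ^ 2)) := by
    rw [Real.sqrt_mul (sq_nonneg _), Real.sqrt_sq (by linarith)]
  rw [hfinal, frobNorm, hfrob]
  -- Monotonicity of `√` holds on all of `ℝ`, so a negative radicand needs no separate case.
  refine Real.sqrt_le_sqrt (mul_le_mul_of_nonneg_left ?_ (sq_nonneg _))
  have h3 := mul_le_mul_of_nonneg_left hEb (by positivity : 0 ≤ (1 / (t : ℝ)) ^ 2)
  rw [← mul_assoc, ← mul_pow, one_div, inv_mul_cancel₀ ht'.ne', one_pow, one_mul] at h3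
  rw [one_div]
  linarith

/-- The indicator of the unsampled indices, nonzero since `c < m`, is an eigenvector of the residual
with eigenvalue `(1 - α) (1 + (m - c) / (c + β))`. -/
theorem specNorm_sub_nystrom_ge {c : ℕ} {m : ℕ} {α : ℝ} (h0 : 0 < α) (h1 : α < 1) (hcm : c < m)
    (s : Fin c ↪ Fin m) :
    (1 - α) * ((m + (1 - α) / α) / (c + (1 - α) / α)) ≤
      specNorm (partMat (fun _ : Fin m => ()) α - nystrom (partMat (fun _ : Fin m => ()) α) s) := by
  set π : Fin m → Unit := fun _ => () with hπ
  have hcount : ∀ b, blockCount π s b = c := fun b => by simp [blockCount, hπ]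
  have hβ : 0 < (1 - α) / α := div_pos (by linarith) h0
  have hsum : ∑ x, unsampled s x = m - c := by
    have h := sum_unsampled_fiber (π := π) (b := ()) (p := m) (by simp [hπ]) s
    rw [hcount] at h
    simpa [hπ] using h
  have hcm' : (c : ℝ) < m := by exact_mod_cast hcm
  have hne : unsampled s ≠ 0 := by
    intro h
    simp only [h, Pi.zero_apply, Finset.sum_const_zero] at hsum
    linarith
  refine le_specNorm_of_mulVec hne ?_
  ext x
  simp only [Matrix.mulVec, dotProduct, sub_nystrom_partMat π h0.le h1, hcount, Pi.smul_apply,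
    smul_eq_mul, if_true]
  have h : ∀ y, (1 - α) * (unsampled s x * unsampled s y * ((if x = y then 1 else 0) +
      residualCoeff α c)) * unsampled s y =
      (1 - α) * unsampled s x * ((if x = y then unsampled s y * unsampled s y else 0) +
        residualCoeff α c * unsampled s y) := by
    intro y
    split_ifs
    · linear_combination ((1 - α) * unsampled s x * residualCoeff α c) * unsampled_mul_self s y
    · linear_combination ((1 - α) * unsampled s x * residualCoeff α c) * unsampled_mul_self s y
  rw [Finset.sum_congr rfl fun y _ => h y, ← Finset.mul_sum, Finset.sum_add_distrib,
    ← Finset.mul_sum, hsum, Finset.sum_ite_eq, if_pos (Finset.mem_univ _), unsampled_mul_self,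
    residualCoeff_eq h0]
  have hden : (c : ℝ) + (1 - α) / α ≠ 0 := by positivity
  have e : (m + (1 - α) / α) / (c + (1 - α) / α) =
      1 + 1 / (c + (1 - α) / α) * (m - c) := by
    generalize (1 - α) / α = β at hden
    field_simp; ring
  rw [e]
  linear_combination (1 - α) * unsampled_mul_self s x

end ResidualNorms

/-! ### The error of the best rank-`k` approximation -/

section BestApproximation

variable {n κ : Type*} [Fintype n] [DecidableEq n] [Fintype κ] [DecidableEq κ]

/-- The indicator matrix of the partition of the indices given by the fibres of `π`. -/
def partInd {n κ : Type*} [DecidableEq κ] (π : n → κ) : Matrix n n ℝ :=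
  Matrix.of fun x y => if π x = π y then 1 else 0

theorem partInd_mul_self {n κ : Type*} [Fintype n] [DecidableEq κ] {p : ℕ} {π : n → κ}
    (hp : ∀ b, (Finset.univ.filter fun x => π x = b).card = p) :
    partInd π * partInd π = (p : ℝ) • partInd π := by
  ext x y
  have h : ∀ z, partInd π x z * partInd π z y = if π z = π x then partInd π x y else 0 := by
    intro z
    simp only [partInd, Matrix.of_apply]
    by_cases e : π x = π z
    · simp [e]
    · have e' : ¬ π z = π x := fun h => e h.symm
      simp [e, e']
  rw [Matrix.mul_apply, Finset.sum_congr rfl fun z _ => h z, ← Finset.sum_filter]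
  simp [hp]

theorem partMat_mul_self {n κ : Type*} [Fintype n] [DecidableEq n] [DecidableEq κ] {p : ℕ} {π : n → κ}
    (hp : ∀ b, (Finset.univ.filter fun x => π x = b).card = p) (α : ℝ) :
    (partMat π α)ᵀ * partMat π α = (1 - α) ^ 2 • (1 : Matrix n n ℝ) +
      (2 * (1 - α) * α + p * α ^ 2) • partInd π := by
  have h : partMat π α = (1 - α) • (1 : Matrix n n ℝ) + α • partInd π := by
    ext x y
    simp [partMat, partInd, Matrix.one_apply]
  rw [partMat_transpose, h, Matrix.mul_add, Matrix.add_mul, Matrix.add_mul]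
  simp only [Matrix.smul_mul, Matrix.mul_smul, Matrix.one_mul, Matrix.mul_one,
    partInd_mul_self hp, smul_smul]
  module

/-- The singular values outside the `k` largest ones are all equal to `1 - α`. -/
theorem IsTruncatedSVD.sub_eq {p k : ℕ} {π : n → κ} (hp0 : 0 < p)
    (hp : ∀ b, (Finset.univ.filter fun x => π x = b).card = p) {α : ℝ} (h0 : 0 < α) (h1 : α < 1)
    (hk : Fintype.card κ ≤ k) {Ak : Matrix n n ℝ} (hA : IsTruncatedSVD (partMat π α) k Ak) :
    ∃ (U V : Matrix n n ℝ) (T : Finset n),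
      U ∈ Matrix.orthogonalGroup n ℝ ∧ V ∈ Matrix.orthogonalGroup n ℝ ∧ T.card = k ∧
      partMat π α - Ak = U * diagonal (fun i => if i ∈ T then 0 else 1 - α) * Vᵀ := by
  obtain ⟨U, V, σ, T, hU, hV, hσ, hT, hmax, hsvd, hAk⟩ := hA
  refine ⟨U, V, T, hU, hV, hT, ?_⟩
  set e : ℝ := 2 * (1 - α) * α + p * α ^ 2 with he
  have hppos : (0 : ℝ) < p := by exact_mod_cast hp0
  have hepos : 0 < e := by
    have : 0 < 1 - α := by linarith
    positivity
  have h1' : Vᵀ * V = 1 := (Matrix.mem_orthogonalGroup_iff' n ℝ).1 hV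
  have h2' : V * Vᵀ = 1 := (Matrix.mem_orthogonalGroup_iff n ℝ).1 hV
  -- In the basis given by `V`, the shifted squares of the singular values are the diagonal form of
  -- `e J`. The relation `J² = p J` forces each to be `0` or `e p`, and the trace shows that `e p`
  -- occurs exactly once per block.
  have hD : diagonal (fun i => σ i ^ 2 - (1 - α) ^ 2) = e • (Vᵀ * partInd π * V) := by
    have h := partMat_mul_self hp α
    have h3 := transpose_mul_self_eq (V := V) σ hU
    rw [← hsvd, h] at h3
    have h4 : Vᵀ * (V * diagonal (fun i => σ i ^ 2) * Vᵀ) * V = diagonal fun i => σ i ^ 2 := by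
      calc _ = (Vᵀ * V) * diagonal (fun i => σ i ^ 2) * (Vᵀ * V) := by
            simp only [Matrix.mul_assoc]
        _ = _ := by rw [h1', Matrix.one_mul, Matrix.mul_one]
    rw [← h3, Matrix.mul_add, Matrix.add_mul] at h4
    simp only [Matrix.mul_smul, Matrix.smul_mul, Matrix.mul_one, h1'] at h4
    have h5 : diagonal (fun i => σ i ^ 2 - (1 - α) ^ 2) =
        diagonal (fun i => σ i ^ 2) - (1 - α) ^ 2 • (1 : Matrix n n ℝ) := by
      ext x y
      by_cases hxy : x = y
      · subst hxy; simp
      · simp [hxy]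
    rw [h5, ← h4, add_sub_cancel_left]
  have hDD : ∀ i, (σ i ^ 2 - (1 - α) ^ 2) * (σ i ^ 2 - (1 - α) ^ 2) =
      (e * p) * (σ i ^ 2 - (1 - α) ^ 2) := by
    have h : diagonal (fun i => σ i ^ 2 - (1 - α) ^ 2) * diagonal (fun i => σ i ^ 2 - (1 - α) ^ 2) =
        (e * p) • diagonal (fun i => σ i ^ 2 - (1 - α) ^ 2) := by
      rw [hD, Matrix.smul_mul, Matrix.mul_smul]
      have : Vᵀ * partInd π * V * (Vᵀ * partInd π * V) = (p : ℝ) • (Vᵀ * partInd π * V) := by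
        calc _ = Vᵀ * (partInd π * (V * Vᵀ) * partInd π) * V := by simp only [Matrix.mul_assoc]
          _ = _ := by
            rw [h2', Matrix.mul_one, partInd_mul_self hp, Matrix.mul_smul, Matrix.smul_mul]
      rw [this, smul_smul, smul_smul, smul_smul]
      congr 1; ring
    intro i
    have h' := congr_fun (congr_fun h i) i
    simpa using h'
  have htr : ∑ i, (σ i ^ 2 - (1 - α) ^ 2) = e * p * Fintype.card κ := by
    rw [← Matrix.trace_diagonal, hD, Matrix.trace_smul, Matrix.trace_mul_comm, ← Matrix.mul_assoc,
      h2', Matrix.one_mul]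
    have : (partInd π).trace = p * Fintype.card κ := by
      have h := sum_eq_sum_fiber π (fun _ => 1) fun _ => 1
      simp only [mul_one, Finset.sum_const, hp, Finset.card_univ, nsmul_eq_mul] at h
      simp [Matrix.trace, partInd, h, mul_comm]
    rw [this, smul_eq_mul, mul_assoc]
  have hval : ∀ i, σ i ^ 2 - (1 - α) ^ 2 = 0 ∨ σ i ^ 2 - (1 - α) ^ 2 = e * p := fun i => by
    by_cases h : σ i ^ 2 - (1 - α) ^ 2 = 0
    · exact Or.inl h
    · exact Or.inr (mul_right_cancel₀ h (hDD i))
  have hep : 0 < e * p := mul_pos hepos hppos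
  set L := Finset.univ.filter fun i => σ i ^ 2 - (1 - α) ^ 2 = e * p with hL
  have hLcard : L.card = Fintype.card κ := by
    have h : ∑ i, (σ i ^ 2 - (1 - α) ^ 2) = L.card * (e * p) := by
      rw [hL, ← nsmul_eq_mul, ← Finset.sum_const, Finset.sum_filter]
      refine Finset.sum_congr rfl fun i _ => ?_
      split_ifs with h
      · exact h
      · exact (hval i).resolve_right h
    rw [htr, mul_comm] at h
    exact_mod_cast (mul_right_cancel₀ hep.ne' h).symm
  have htail : ∀ j ∉ T, σ j = 1 - α := by
    intro j hj
    rcases hval j with h | h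
    · have : (σ j - (1 - α)) * (σ j + (1 - α)) = 0 := by linear_combination h
      rcases mul_eq_zero.1 this with h' | h'
      · linarith
      · have := hσ j; linarith
    · exfalso
      -- A large singular value outside `T` would make all of `T` large as well, giving `k + 1`
      -- large values where there are only `Fintype.card κ ≤ k`. The inequality suffices, so the
      -- one-block matrix is covered for every `k ≥ 1`.
      have hsub : insert j T ⊆ L := by
        intro i hi
        rw [hL, Finset.mem_filter]
        refine ⟨Finset.mem_univ _, ?_⟩
        rcases Finset.mem_insert.1 hi with rfl | hi
        · exact h
        · refine (hval i).resolve_left fun h' => ?_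
          have := pow_le_pow_left₀ (hσ j) (hmax i hi j hj) 2
          linarith
      have := Finset.card_le_card hsub
      rw [Finset.card_insert_of_notMem hj, hT, hLcard] at this
      omega
  rw [hAk, hsvd, ← Matrix.sub_mul, ← Matrix.mul_sub, Matrix.diagonal_sub]
  congr 3
  ext i
  split_ifs with h
  · simp
  · simp [htail i h]

theorem sum_ite_mem_compl (T : Finset n) (a : ℝ) :
    (∑ i, if i ∈ T then 0 else a) = ((Fintype.card n : ℝ) - T.card) * a := by
  have h : ∀ i, (if i ∈ T then 0 else a) = a - if i ∈ T then a else 0 := fun i => by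
    split_ifs <;> simp
  simp only [h, Finset.sum_sub_distrib]
  simp [Finset.sum_ite_mem]
  ring

variable {p k : ℕ} {π : n → κ} {α : ℝ} {Ak : Matrix n n ℝ}

theorem IsTruncatedSVD.frobNorm_sub (hp0 : 0 < p)
    (hp : ∀ b, (Finset.univ.filter fun x => π x = b).card = p) (h0 : 0 < α) (h1 : α < 1)
    (hk : Fintype.card κ ≤ k) (hA : IsTruncatedSVD (partMat π α) k Ak) :
    frobNorm (partMat π α - Ak) = (1 - α) * √((Fintype.card n : ℝ) - k) := by
  obtain ⟨U, V, T, hU, hV, hT, h⟩ := hA.sub_eq hp0 hp h0 h1 hk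
  rw [h, frobNorm_mul_diagonal_mul _ hU hV]
  have : ∀ i, (if i ∈ T then 0 else 1 - α) ^ 2 = if i ∈ T then 0 else (1 - α) ^ 2 := fun i => by
    split_ifs <;> simp
  simp only [this]
  rw [sum_ite_mem_compl, hT, mul_comm, Real.sqrt_mul (sq_nonneg _), Real.sqrt_sq (by linarith)]

theorem IsTruncatedSVD.nucNorm_sub (hp0 : 0 < p)
    (hp : ∀ b, (Finset.univ.filter fun x => π x = b).card = p) (h0 : 0 < α) (h1 : α < 1)
    (hk : Fintype.card κ ≤ k) (hA : IsTruncatedSVD (partMat π α) k Ak) :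
    nucNorm (partMat π α - Ak) = (1 - α) * ((Fintype.card n : ℝ) - k) := by
  obtain ⟨U, V, T, hU, hV, hT, h⟩ := hA.sub_eq hp0 hp h0 h1 hk
  rw [h, nucNorm_mul_diagonal_mul hU hV fun i => by split_ifs <;> linarith, sum_ite_mem_compl, hT,
    mul_comm]

theorem IsTruncatedSVD.specNorm_sub (hp0 : 0 < p)
    (hp : ∀ b, (Finset.univ.filter fun x => π x = b).card = p) (h0 : 0 < α) (h1 : α < 1)
    (hk : Fintype.card κ ≤ k) (hkn : k < Fintype.card n)
    (hA : IsTruncatedSVD (partMat π α) k Ak) : specNorm (partMat π α - Ak) = 1 - α := by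
  obtain ⟨U, V, T, hU, hV, hT, h⟩ := hA.sub_eq hp0 hp h0 h1 hk
  have hα : 0 ≤ 1 - α := by linarith
  rw [h, specNorm_mul_diagonal_mul _ hU hV]
  obtain ⟨j, hj⟩ : ∃ j, j ∉ T := by
    by_contra! hall
    rw [← hT, Finset.eq_univ_iff_forall.2 hall, Finset.card_univ] at hkn
    exact lt_irrefl _ hkn
  refine le_antisymm ((pi_norm_le_iff_of_nonneg hα).2 fun i => ?_) ?_
  · split_ifs
    · simpa using hα
    · rw [Real.norm_of_nonneg hα]
  · have h2 := norm_le_pi_norm (fun i => if i ∈ T then 0 else 1 - α) j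
    simpa only [hj, if_false, Real.norm_of_nonneg hα] using h2

end BestApproximation

/-! ### Specialization to the adversarial matrices -/

section Adversarial

theorem maxAbs_partMat {n κ : Type*} [Fintype n] [DecidableEq n] [DecidableEq κ] [Nonempty n]
    (π : n → κ) {α : ℝ} (h0 : 0 ≤ α) (h1 : α ≤ 1) : maxAbs (partMat π α) = 1 := by
  have hle : ∀ q : n × n, |partMat π α q.1 q.2| ≤ 1 := by
    rintro ⟨x, y⟩
    simp only [partMat, Matrix.of_apply]
    rw [abs_le]
    by_cases e : x = y
    · subst e; simp
    · simp only [e, if_false]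
      split_ifs <;> constructor <;> linarith
  refine le_antisymm (ciSup_le hle) ?_
  let x := Classical.arbitrary n
  have h := le_ciSup (f := fun q : n × n => |partMat π α q.1 q.2|)
    ⟨1, by rintro _ ⟨q, rfl⟩; exact hle q⟩ (x, x)
  have hx : |partMat π α x x| = 1 := by simp [partMat]
  exact hx ▸ h

theorem matB_eq_partMat (m : ℕ) (α : ℝ) : matB m α = partMat (fun _ : Fin m => ()) α := by
  ext x y
  simp [matB, partMat, Matrix.one_apply]

theorem matA_eq_partMat (k p : ℕ) (α : ℝ) :
    matA k p α = partMat (Prod.snd : Fin p × Fin k → Fin k) α := by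
  ext ⟨x, a⟩ ⟨y, b⟩
  rw [matA, Matrix.blockDiagonal_apply]
  by_cases e : a = b
  · simp [matB, partMat, Matrix.one_apply, e]
  · simp [partMat, e]

theorem card_filter_snd (k p : ℕ) (b : Fin k) :
    (Finset.univ.filter fun x : Fin p × Fin k => x.2 = b).card = p := by
  have h : (Finset.univ.filter fun x : Fin p × Fin k => x.2 = b) = Finset.univ ×ˢ {b} := by
    ext ⟨x, a⟩; simp [eq_comm]
  simp [h]

theorem ensemble_one {n : Type*} {c : ℕ} (A : Matrix n n ℝ) (s : Fin c ↪ n) :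
    ensemble (fun _ => 1 / ((1 : ℕ) : ℝ)) A (fun _ : Fin 1 => s) = nystrom A s := by
  simp [ensemble]

theorem nonOverlapping_one {n : Type*} {c : ℕ} (s : Fin c ↪ n) :
    NonOverlapping fun _ : Fin 1 => s :=
  fun i j h => absurd (Subsingleton.elim i j) h

/-- Supplies `t c ≤ m`, on which the limiting ensemble Frobenius bound depends. -/
theorem NonOverlapping.mul_le_card {n : Type*} [Fintype n] {t c : ℕ} {s : Fin t → (Fin c ↪ n)}
    (hs : NonOverlapping s) : t * c ≤ Fintype.card n := by
  have hinj : Function.Injective fun q : Fin t × Fin c => s q.1 q.2 := by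
    rintro ⟨i, a⟩ ⟨j, b⟩ h
    by_cases e : i = j
    · subst e
      exact congr_arg _ ((s i).injective h)
    · exact absurd h (Set.disjoint_left.1 (hs e) ⟨a, rfl⟩ ∘ fun h' => ⟨b, h'.symm⟩)
  simpa using Fintype.card_le_of_injective _ hinj

variable {m k p t c : ℕ} {α : ℝ}

theorem frobNorm_matA_sub_ensemble_ge (hm : m = k * p) (hk : 0 < k) (ht : 0 < t) (h0 : 0 < α)
    (h1 : α < 1) {s : Fin t → (Fin c ↪ Fin p × Fin k)} (hs : NonOverlapping s) :
    (1 - α) * √(((m : ℝ) - 2 * c + c / t - k) +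
        k * ((m - c + c / t + (1 - α) / α * k) / (c + (1 - α) / α * k)) ^ 2) ≤
      frobNorm (matA k p α - ensemble (fun _ => 1 / (t : ℝ)) (matA k p α) s) := by
  have : Nonempty (Fin k) := ⟨⟨0, hk⟩⟩
  rw [matA_eq_partMat]
  exact frobNorm_sub_ensemble_ge ht (card_filter_snd k p) h0 h1 hs (by simp)
    (by rw [hm, Nat.cast_mul])

theorem nucNorm_matA_sub_ensemble_ge (hm : m = k * p) (hk : 0 < k) (ht : 0 < t) (h0 : 0 < α)
    (h1 : α < 1) (s : Fin t → (Fin c ↪ Fin p × Fin k)) :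
    (1 - α) * (((m : ℝ) - c) * (1 + k / (c + (1 - α) / α * k))) ≤
      nucNorm (matA k p α - ensemble (fun _ => 1 / (t : ℝ)) (matA k p α) s) := by
  have : Nonempty (Fin k) := ⟨⟨0, hk⟩⟩
  rw [matA_eq_partMat]
  exact nucNorm_sub_ensemble_ge ht (card_filter_snd k p) h0 h1 s (by simp)
    (by rw [hm, Nat.cast_mul])

theorem maxAbs_matA (hm : m = k * p) (hm0 : 0 < m) (h0 : 0 ≤ α) (h1 : α ≤ 1) :
    maxAbs (matA k p α) = 1 := by
  subst hm
  have : Nonempty (Fin p × Fin k) :=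
    ⟨⟨0, Nat.pos_of_mul_pos_left hm0⟩, ⟨0, Nat.pos_of_mul_pos_right hm0⟩⟩
  rw [matA_eq_partMat, maxAbs_partMat _ h0 h1]

theorem frobNorm_matA_sub_ensemble_div_ge (hm : m = k * p) (hk : 0 < k) (hkm : k < m) (ht : 0 < t)
    (h0 : 0 < α) (h1 : α < 1) {s : Fin t → (Fin c ↪ Fin p × Fin k)} (hs : NonOverlapping s)
    {Ak : Matrix (Fin p × Fin k) (Fin p × Fin k) ℝ} (hA : IsTruncatedSVD (matA k p α) k Ak) :
    √((((m : ℝ) - 2 * c + c / t - k) +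
        k * ((m - c + c / t + (1 - α) / α * k) / (c + (1 - α) / α * k)) ^ 2) / (m - k)) ≤
      frobNorm (matA k p α - ensemble (fun _ => 1 / (t : ℝ)) (matA k p α) s) /
        frobNorm (matA k p α - Ak) := by
  have h := frobNorm_matA_sub_ensemble_ge hm hk ht h0 h1 hs
  have hp0 : 0 < p := Nat.pos_of_mul_pos_left (hm ▸ hk.trans hkm)
  have hmk : (0 : ℝ) < m - k := sub_pos.2 (by exact_mod_cast hkm)
  have hα : 0 < 1 - α := by linarith
  have hden : frobNorm (matA k p α - Ak) = (1 - α) * √((m : ℝ) - k) := by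
    rw [matA_eq_partMat] at hA ⊢
    rw [hA.frobNorm_sub hp0 (card_filter_snd k p) h0 h1 (by simp)]
    simp [hm, mul_comm]
  rw [hden, Real.sqrt_div' _ hmk.le, le_div_iff₀ (mul_pos hα (Real.sqrt_pos.2 hmk))]
  refine le_trans (le_of_eq ?_) h
  have := (Real.sqrt_pos.2 hmk).ne'
  field_simp

theorem nucNorm_matA_sub_ensemble_div_ge (hm : m = k * p) (hk : 0 < k) (hkm : k < m) (ht : 0 < t)
    (h0 : 0 < α) (h1 : α < 1) (s : Fin t → (Fin c ↪ Fin p × Fin k))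
    {Ak : Matrix (Fin p × Fin k) (Fin p × Fin k) ℝ} (hA : IsTruncatedSVD (matA k p α) k Ak) :
    ((m : ℝ) - c) / (m - k) * (1 + k / (c + (1 - α) / α * k)) ≤
      nucNorm (matA k p α - ensemble (fun _ => 1 / (t : ℝ)) (matA k p α) s) /
        nucNorm (matA k p α - Ak) := by
  have h := nucNorm_matA_sub_ensemble_ge hm hk ht h0 h1 s
  have hp0 : 0 < p := Nat.pos_of_mul_pos_left (hm ▸ hk.trans hkm)
  have hmk : (0 : ℝ) < m - k := sub_pos.2 (by exact_mod_cast hkm)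
  have hα : 0 < 1 - α := by linarith
  have hden : nucNorm (matA k p α - Ak) = (1 - α) * ((m : ℝ) - k) := by
    rw [matA_eq_partMat] at hA ⊢
    rw [hA.nucNorm_sub hp0 (card_filter_snd k p) h0 h1 (by simp)]
    simp [hm, mul_comm]
  rw [hden, le_div_iff₀ (mul_pos hα hmk)]
  refine le_trans (le_of_eq ?_) h
  generalize (1 - α) / α = β
  field_simp

theorem specNorm_matB_sub_nystrom_div_ge (hk : 0 < k) (hkm : k < m) (hcm : c < m)
    (h0 : 0 < α) (h1 : α < 1) (s : Fin c ↪ Fin m) {Bk : Matrix (Fin m) (Fin m) ℝ}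
    (hB : IsTruncatedSVD (matB m α) k Bk) :
    (m + (1 - α) / α) / (c + (1 - α) / α) ≤
      specNorm (matB m α - nystrom (matB m α) s) / specNorm (matB m α - Bk) := by
  rw [matB_eq_partMat] at hB ⊢
  rw [hB.specNorm_sub (hk.trans hkm) (by simp) h0 h1 (by simpa using Nat.succ_le_of_lt hk) (by simpa using hkm),
    le_div_iff₀ (by linarith), mul_comm]
  exact specNorm_sub_nystrom_ge h0 h1 hcm s

open Filter Topology in
/-- A property that holds near `0` holds for `(1 - α) / α` when `α < 1` is close to `1`. -/
theorem exists_forall_Ioo_of_eventually {P : ℝ → Prop} (hP : ∀ᶠ β in 𝓝 0, P β) :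
    ∃ α₀ ∈ Set.Ico (0 : ℝ) 1, ∀ α ∈ Set.Ioo α₀ 1, P ((1 - α) / α) := by
  have hcont : Tendsto (fun α : ℝ => (1 - α) / α) (𝓝 1) (𝓝 0) := by
    have h : ContinuousAt (fun α : ℝ => (1 - α) / α) 1 :=
      (continuousAt_const.sub continuousAt_id).div continuousAt_id one_ne_zero
    simpa [ContinuousAt] using h
  obtain ⟨δ, hδ, h⟩ := Metric.eventually_nhds_iff.1 (hcont.eventually hP)
  refine ⟨max 0 (1 - δ), ⟨le_max_left _ _, max_lt one_pos (by linarith)⟩, fun α hα => h ?_⟩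
  rw [Real.dist_eq, abs_lt]
  have := (le_max_right _ _).trans_lt hα.1
  constructor <;> linarith [hα.2]

open Filter Topology in
theorem eventually_sub_le {F : ℝ → ℝ} (hF : ContinuousAt F 0) {a ε : ℝ} (ha : a ≤ F 0)
    (hε : 0 < ε) : ∀ᶠ β in 𝓝 0, a - ε ≤ F β := by
  filter_upwards [hF.eventually (lt_mem_nhds (show F 0 - ε < F 0 by linarith))] with β hβ
  linarith

theorem continuousAt_frob_bound {m k c : ℝ} (hc : 0 < c) (a b : ℝ) :
    ContinuousAt (fun β : ℝ => √((a + k * ((b + β * k) / (c + β * k)) ^ 2) / (m - k))) 0 := by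
  have h : c + 0 * k ≠ 0 := by simpa using hc.ne'
  fun_prop (disch := assumption)

theorem continuousAt_nuc_bound {k c : ℝ} (hc : 0 < c) (a : ℝ) :
    ContinuousAt (fun β : ℝ => a * (1 + k / (c + β * k))) 0 := by
  have h : c + 0 * k ≠ 0 := by simpa using hc.ne'
  fun_prop (disch := assumption)

/-- The claimed relative bound is weaker than the limit at `β = 0`. With `a = m - 2c + c / t`, the
numerators differ by `2ka / c + k + k²a / c²`, and `a ≥ 0` because `t c ≤ m` and `t c - 2c + c / t =
c (t - 1)² / t`. -/
theorem ensemble_frob_limit_le {m k t c : ℝ} (ht : 1 ≤ t) (hc : 0 < c) (hk : 0 < k) (hkm : k < m)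
    (htc : t * c ≤ m) :
    (m - 2 * c + c / t - k) / (m - k) * (1 + k * (m - 2 * c + c / t) / c ^ 2) ≤
      ((m - 2 * c + c / t - k) + k * ((m - c + c / t + 0 * k) / (c + 0 * k)) ^ 2) / (m - k) := by
  have hmk : 0 < m - k := by linarith
  have htpos : 0 < t := by linarith
  have ha : 0 ≤ m - 2 * c + c / t := by
    have h : t * c - 2 * c + c / t = c * (t - 1) ^ 2 / t := by field_simp; ring
    have : 0 ≤ c * (t - 1) ^ 2 / t := by positivity
    linarith
  have h2 : m - c + c / t + 0 * k = (m - 2 * c + c / t) + c := by ring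
  rw [h2, zero_mul, add_zero]
  generalize m - 2 * c + c / t = a at ha
  rw [div_mul_eq_mul_div, div_le_div_iff_of_pos_right hmk]
  have h3 : (a - k) + k * ((a + c) / c) ^ 2 =
      (a - k) * (1 + k * a / c ^ 2) + (2 * k * a / c + k + k ^ 2 * a / c ^ 2) := by
    field_simp; ring
  rw [h3]
  have : 0 ≤ 2 * k * a / c + k + k ^ 2 * a / c ^ 2 := by positivity
  linarith

end Adversarial

end Nystrom

end

/-! ### The additive bounds at `β = 99` and the relative bounds as `β → 0`. -/

theorem theorem8 :
    -- both families consist of SPSD matrices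
    (∀ (m : ℕ) (α : ℝ), 0 ≤ α → α < 1 → (Nystrom.matB m α).PosSemidef) ∧
    (∀ (k p : ℕ) (α : ℝ), 0 ≤ α → α < 1 → (Nystrom.matA k p α).PosSemidef) ∧
    -- standard method, errors relative to the largest entry (`α = 1/100`)
    (∀ m c : ℕ, 0 < c → c < m → ∀ s : Fin c ↪ Fin m,
      0.99 * ((m : ℝ) + 99) / ((c : ℝ) + 99) ≤
        Nystrom.specNorm (Nystrom.matB m 0.01 - Nystrom.nystrom (Nystrom.matB m 0.01) s) /
          Nystrom.maxAbs (Nystrom.matB m 0.01)) ∧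
    (∀ m k p c : ℕ, m = k * p → 0 < k → k < m → 0 < c → c < m →
      ∀ s : Fin c ↪ Fin p × Fin k,
        0.99 * √((m : ℝ) - c - k + k * (((m : ℝ) + 99 * k) / ((c : ℝ) + 99 * k)) ^ 2) ≤
          Nystrom.frobNorm (Nystrom.matA k p 0.01 - Nystrom.nystrom (Nystrom.matA k p 0.01) s) /
            Nystrom.maxAbs (Nystrom.matA k p 0.01) ∧
        0.99 * ((m : ℝ) - c) * (1 + (k : ℝ) / ((c : ℝ) + 99 * k)) ≤
          Nystrom.nucNorm (Nystrom.matA k p 0.01 - Nystrom.nystrom (Nystrom.matA k p 0.01) s) /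
            Nystrom.maxAbs (Nystrom.matA k p 0.01)) ∧
    -- ensemble method, errors relative to the largest entry (`α = 1/100`)
    (∀ m k p t c : ℕ, m = k * p → 0 < k → k < m → 0 < t → 0 < c → c < m →
      ∀ s : Fin t → (Fin c ↪ Fin p × Fin k), Nystrom.NonOverlapping s →
        0.99 * √(((m : ℝ) - 2 * c + (c : ℝ) / t - k) +
            k * (((m : ℝ) - c + (c : ℝ) / t + 99 * k) / ((c : ℝ) + 99 * k)) ^ 2) ≤
          Nystrom.frobNorm (Nystrom.matA k p 0.01 -
              Nystrom.ensemble (fun _ => 1 / (t : ℝ)) (Nystrom.matA k p 0.01) s) /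
            Nystrom.maxAbs (Nystrom.matA k p 0.01) ∧
        0.99 * ((m : ℝ) - c) * (1 + (k : ℝ) / ((c : ℝ) + 99 * k)) ≤
          Nystrom.nucNorm (Nystrom.matA k p 0.01 -
              Nystrom.ensemble (fun _ => 1 / (t : ℝ)) (Nystrom.matA k p 0.01) s) /
            Nystrom.maxAbs (Nystrom.matA k p 0.01)) ∧
    -- standard method, errors relative to the best rank-`k` approximation (`α → 1`)
    (∀ m k c : ℕ, 0 < k → k < m → 0 < c → c < m →
      ∀ ε : ℝ, 0 < ε → ∃ α₀ ∈ Set.Ico (0 : ℝ) 1, ∀ α ∈ Set.Ioo α₀ 1,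
        ∀ s : Fin c ↪ Fin m, ∀ Bk, Nystrom.IsTruncatedSVD (Nystrom.matB m α) k Bk →
          (m : ℝ) / c - ε ≤
            Nystrom.specNorm (Nystrom.matB m α - Nystrom.nystrom (Nystrom.matB m α) s) /
              Nystrom.specNorm (Nystrom.matB m α - Bk)) ∧
    (∀ m k p c : ℕ, m = k * p → 0 < k → k < m → 0 < c → c < m →
      ∀ ε : ℝ, 0 < ε → ∃ α₀ ∈ Set.Ico (0 : ℝ) 1, ∀ α ∈ Set.Ioo α₀ 1,
        ∀ s : Fin c ↪ Fin p × Fin k, ∀ Ak, Nystrom.IsTruncatedSVD (Nystrom.matA k p α) k Ak →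
          √(1 + ((m : ℝ) ^ 2 * k - (c : ℝ) ^ 3) / ((c : ℝ) ^ 2 * ((m : ℝ) - k))) - ε ≤
            Nystrom.frobNorm (Nystrom.matA k p α - Nystrom.nystrom (Nystrom.matA k p α) s) /
              Nystrom.frobNorm (Nystrom.matA k p α - Ak) ∧
          ((m : ℝ) - c) / ((m : ℝ) - k) * (1 + (k : ℝ) / c) - ε ≤
            Nystrom.nucNorm (Nystrom.matA k p α - Nystrom.nystrom (Nystrom.matA k p α) s) /
              Nystrom.nucNorm (Nystrom.matA k p α - Ak)) ∧
    -- ensemble method, errors relative to the best rank-`k` approximation (`α → 1`)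
    (∀ m k p t c : ℕ, m = k * p → 0 < k → k < m → 0 < t → 0 < c → c < m →
      ∀ ε : ℝ, 0 < ε → ∃ α₀ ∈ Set.Ico (0 : ℝ) 1, ∀ α ∈ Set.Ioo α₀ 1,
        ∀ s : Fin t → (Fin c ↪ Fin p × Fin k), Nystrom.NonOverlapping s →
        ∀ Ak, Nystrom.IsTruncatedSVD (Nystrom.matA k p α) k Ak →
          √(((m : ℝ) - 2 * c + (c : ℝ) / t - k) / ((m : ℝ) - k) *
              (1 + k * ((m : ℝ) - 2 * c + (c : ℝ) / t) / (c : ℝ) ^ 2)) - ε ≤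
            Nystrom.frobNorm (Nystrom.matA k p α -
                Nystrom.ensemble (fun _ => 1 / (t : ℝ)) (Nystrom.matA k p α) s) /
              Nystrom.frobNorm (Nystrom.matA k p α - Ak) ∧
          ((m : ℝ) - c) / ((m : ℝ) - k) * (1 + (k : ℝ) / c) - ε ≤
            Nystrom.nucNorm (Nystrom.matA k p α -
                Nystrom.ensemble (fun _ => 1 / (t : ℝ)) (Nystrom.matA k p α) s) /
              Nystrom.nucNorm (Nystrom.matA k p α - Ak)) := by
  have hβ : (1 - 0.01 : ℝ) / 0.01 = 99 := by norm_num
  have hα : (1 - 0.01 : ℝ) = 0.99 := by norm_num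
  have hadd : ∀ m k p t c : ℕ, m = k * p → 0 < k → k < m → 0 < t →
      ∀ s : Fin t → (Fin c ↪ Fin p × Fin k), Nystrom.NonOverlapping s →
        0.99 * √(((m : ℝ) - 2 * c + (c : ℝ) / t - k) +
            k * (((m : ℝ) - c + (c : ℝ) / t + 99 * k) / ((c : ℝ) + 99 * k)) ^ 2) ≤
          Nystrom.frobNorm (Nystrom.matA k p 0.01 -
              Nystrom.ensemble (fun _ => 1 / (t : ℝ)) (Nystrom.matA k p 0.01) s) /
            Nystrom.maxAbs (Nystrom.matA k p 0.01) ∧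
        0.99 * ((m : ℝ) - c) * (1 + (k : ℝ) / ((c : ℝ) + 99 * k)) ≤
          Nystrom.nucNorm (Nystrom.matA k p 0.01 -
              Nystrom.ensemble (fun _ => 1 / (t : ℝ)) (Nystrom.matA k p 0.01) s) /
            Nystrom.maxAbs (Nystrom.matA k p 0.01) := by
    intro m k p t c hm hk hkm ht s hs
    have h1 := Nystrom.frobNorm_matA_sub_ensemble_ge (α := 0.01) hm hk ht (by norm_num)
      (by norm_num) hs
    have h2 := Nystrom.nucNorm_matA_sub_ensemble_ge (α := 0.01) hm hk ht (by norm_num)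
      (by norm_num) s
    rw [hβ, hα] at h1 h2
    rw [Nystrom.maxAbs_matA hm (hk.trans hkm) (by norm_num) (by norm_num), div_one, div_one,
      mul_assoc]
    exact ⟨h1, h2⟩
  -- The Frobenius target `a` is left free: the standard method takes the limit at `β = 0` itself,
  -- the ensemble method a smaller value.
  have hrel : ∀ m k p t c : ℕ, m = k * p → 0 < k → k < m → 0 < t → 0 < c →
      ∀ ε : ℝ, 0 < ε → ∀ a : ℝ,
      a ≤ √((((m : ℝ) - 2 * c + c / t - k) +
        k * ((m - c + c / t + 0 * k) / (c + 0 * k)) ^ 2) / (m - k)) →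
      ∃ α₀ ∈ Set.Ico (0 : ℝ) 1, ∀ α ∈ Set.Ioo α₀ 1,
        ∀ s : Fin t → (Fin c ↪ Fin p × Fin k), Nystrom.NonOverlapping s →
        ∀ Ak, Nystrom.IsTruncatedSVD (Nystrom.matA k p α) k Ak →
          a - ε ≤ Nystrom.frobNorm (Nystrom.matA k p α -
                Nystrom.ensemble (fun _ => 1 / (t : ℝ)) (Nystrom.matA k p α) s) /
              Nystrom.frobNorm (Nystrom.matA k p α - Ak) ∧
          ((m : ℝ) - c) / ((m : ℝ) - k) * (1 + (k : ℝ) / c) - ε ≤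
            Nystrom.nucNorm (Nystrom.matA k p α -
                Nystrom.ensemble (fun _ => 1 / (t : ℝ)) (Nystrom.matA k p α) s) /
              Nystrom.nucNorm (Nystrom.matA k p α - Ak) := by
    intro m k p t c hm hk hkm ht hc ε hε a ha
    have hc' : (0 : ℝ) < c := by exact_mod_cast hc
    obtain ⟨α₀, hα₀, h⟩ := Nystrom.exists_forall_Ioo_of_eventually
      ((Nystrom.eventually_sub_le (Nystrom.continuousAt_frob_bound hc' _ _) ha hε).and
        (Nystrom.eventually_sub_le (Nystrom.continuousAt_nuc_bound (k := k) hc'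
          (((m : ℝ) - c) / (m - k))) (a := ((m : ℝ) - c) / (m - k) * (1 + k / c)) (by simp) hε))
    refine ⟨α₀, hα₀, fun α hα' s hs Ak hA => ⟨(h α hα').1.trans ?_, (h α hα').2.trans ?_⟩⟩
    · exact Nystrom.frobNorm_matA_sub_ensemble_div_ge hm hk hkm ht (hα₀.1.trans_lt hα'.1) hα'.2
        hs hA
    · exact Nystrom.nucNorm_matA_sub_ensemble_div_ge hm hk hkm ht (hα₀.1.trans_lt hα'.1) hα'.2
        s hA
  refine ⟨?_, ?_, ?_, ?_, ?_, ?_, ?_, ?_⟩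
  · intro m α h0 h1
    rw [Nystrom.matB_eq_partMat]
    exact Nystrom.partMat_posSemidef _ h0 h1
  · intro k p α h0 h1
    rw [Nystrom.matA_eq_partMat]
    exact Nystrom.partMat_posSemidef _ h0 h1
  · intro m c hc hcm s
    have hmax : Nystrom.maxAbs (Nystrom.matB m 0.01) = 1 := by
      have : Nonempty (Fin m) := ⟨⟨0, hc.trans hcm⟩⟩
      rw [Nystrom.matB_eq_partMat, Nystrom.maxAbs_partMat _ (by norm_num) (by norm_num)]
    have h := Nystrom.specNorm_sub_nystrom_ge (α := 0.01) (by norm_num) (by norm_num) hcm s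
    rw [← Nystrom.matB_eq_partMat, hβ, hα] at h
    rw [hmax, div_one, mul_div_assoc]
    exact h
  · intro m k p c hm hk hkm hc hcm s
    have h := hadd m k p 1 c hm hk hkm one_pos (fun _ => s) (Nystrom.nonOverlapping_one s)
    rw [Nystrom.ensemble_one] at h
    refine ⟨le_trans (le_of_eq ?_) h.1, h.2⟩
    congr 2
    push_cast
    ring
  · intro m k p t c hm hk hkm ht hc hcm s hs
    exact hadd m k p t c hm hk hkm ht s hs
  · intro m k c hk hkm hc hcm ε hε
    have hc' : (0 : ℝ) < c := by exact_mod_cast hc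
    have hF : ContinuousAt (fun β : ℝ => ((m : ℝ) + β) / (c + β)) 0 := by
      have h : (c : ℝ) + 0 ≠ 0 := by simpa using hc'.ne'
      fun_prop (disch := assumption)
    obtain ⟨α₀, hα₀, h⟩ := Nystrom.exists_forall_Ioo_of_eventually
      (Nystrom.eventually_sub_le hF (a := (m : ℝ) / c) (by simp) hε)
    refine ⟨α₀, hα₀, fun α hα' s Bk hB => (h α hα').trans ?_⟩
    exact Nystrom.specNorm_matB_sub_nystrom_div_ge hk hkm hcm (hα₀.1.trans_lt hα'.1) hα'.2 s hB
  · intro m k p c hm hk hkm hc hcm ε hε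
    have hc' : (0 : ℝ) < c := by exact_mod_cast hc
    have hmk : (0 : ℝ) < m - k := sub_pos.2 (by exact_mod_cast hkm)
    obtain ⟨α₀, hα₀, h⟩ := hrel m k p 1 c hm hk hkm one_pos hc ε hε
      (√(1 + ((m : ℝ) ^ 2 * k - (c : ℝ) ^ 3) / ((c : ℝ) ^ 2 * ((m : ℝ) - k))))
      (by
        refine le_of_eq (congr_arg _ ?_)
        push_cast
        field_simp
        ring)
    refine ⟨α₀, hα₀, fun α hα' s Ak hA => ?_⟩
    have h' := h α hα' (fun _ => s) (Nystrom.nonOverlapping_one s) Ak hA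
    rwa [Nystrom.ensemble_one] at h'
  · intro m k p t c hm hk hkm ht hc hcm ε hε
    by_cases htc : t * c ≤ m
    · have hc' : (0 : ℝ) < c := by exact_mod_cast hc
      exact hrel m k p t c hm hk hkm ht hc ε hε _ (Real.sqrt_le_sqrt
        (Nystrom.ensemble_frob_limit_le (by exact_mod_cast ht) hc' (by exact_mod_cast hk)
          (by exact_mod_cast hkm) (by exact_mod_cast htc)))
    -- If `t c > m` there are no disjoint samples, so any threshold works.
    · refine ⟨0, by simp, fun α _ s hs => absurd ?_ htc⟩
      have h := hs.mul_le_card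
      rwa [Fintype.card_prod, Fintype.card_fin, Fintype.card_fin, mul_comm p, ← hm] at h
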